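/- **Setting.** Let $n=5f+1$ players play in a partially synchronous network: steps alternate between a scheduler, which picks a player and the in-transit messages delivered to it, and the chosen player, which sends messages and possibly outputs a value (which terminates it). After some finite time GST every message of a non-faulty player is delivered within $\Delta$ steps unless its recipient has terminated, and every non-terminated player is scheduled infinitely often. Channels are authenticated and signatures unforgeable (an action may contain another player's signature only if it was received before); the hash $H$ is injective. A player is *non-faulty* in a play if it follows the protocol throughout. A strategy maps local states (input, received messages, own past actions) to distributions over allowed actions; the scheduler may use any (randomised) strategy that almost surely respects partial synchrony, whatever the players do. **Protocol (NoFork deployment).** An accountable consensus layer is any deterministic protocol that solves consensus (termination, agreement, validity for a given validity notion) whenever at most $f$ players are faulty, whose outputs (predecisions) are certificates of $4f+1$ signed votes for one value in one view, and in which a correct player never signs votes for two values in the same view. After obtaining a predecision $v_i$ with certificate $C_i$, player $i$ broadcasts $(H(v_i),C_i)$ and records the latest such pair received from each player. It decides $v_i$ once $4f+1$ recorded hashes (its own included) equal $H(v_i)$. If it has recorded different hashes with conflicting certificates ($4f+1$ votes each, jointly proving that more than $f$ players voted for different values in the same view), it slashes these players and decides by a fixed deterministic rule. **Utilities.** For a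 play $z$, $\mathrm{cons}(z)=1$ if some non-faulty player decides and all non-faulty players that decide output the same value, which is valid; otherwise $\mathrm{cons}(z)=0$. Let $a(z)\ge1$ be the number of branches, i.e. of distinct values decided by non-faulty players (at least $1$ by convention), $K(z)$ the set of coalition members sharing the loot, $\kappa(z)=|K(z)|$, $w(z)$ the reward winner (if any), $S(z)$ the set of slashed players. A rational player $i$ has payoff $$u_i(z)=\mathbf 1[\mathrm{cons}(z)=1]+\mathbf 1[a(z)\ge 2\wedge i\in K(z)]\frac{(a(z)-1)\mathcal G}{\kappa(z)}+\mathbf 1[w(z)=i]\,\mathcal R-\mathbf 1[i\in S(z)]\,\mathcal L ,$$ and its utility is the expected payoff. A joint strategy $\sigma$ is a *$(k,t)$-robust equilibrium* if for all disjoint sets $K\neq\emptyset$, $T$ of players with $|K|\le k$, $|T|\le t$ and all strategies $\phi_K$, $\tau_T$ there is $i\in K$ such that for every scheduler strategy $\sigma_s$ $$u_i(\sigma_{-T},\tau_T,\sigma_s)\ \ge\ u_i(\sigma_{-(K\cup T)},\phi_K,\tau_T,\sigma_s).$$ **Theorem (Deposit-free robustness in the no-fork regime).** Suppose NoFork finalization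 is used with $\mathcal L=\mathcal R=0$. Then for all $k,t$ with $k+t\le 3f$ and $t\le f$, and for every vector of proposals, the honest profile is a $(k,t)$-robust equilibrium. Moreover, for all disjoint $K,T$ with $|K|\le k$, $|T|\le t$, all deviations $\phi_K,\tau_T$ and every scheduler strategy, the resulting play has $a(z)=1$ almost surely, and every $i\in K$ has utility at most $1$. -/

import Mathlib

open MeasureTheory ProbabilityTheory

namespace NoForkGame

/-! ## Message-passing protocols, histories and plays -/

/-- One move of a player: in each slot `k` at most one message to each player `p`, finitely many
messages altogether, and possibly an output. Producing an output terminates the player. -/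
structure Action (n : ℕ) (M O : Type*) where
  send : Fin n → ℕ → Option M
  out : Option O
  finite_send : ∀ p, {k | send p k ≠ none}.Finite

/-- The move that does nothing. -/
def Action.noop {n : ℕ} {M O : Type*} : Action n M O where
  send := fun _ _ => none
  out := none
  finite_send := by simp

/-- Messages delivered together to a player, each with its true sender (authenticated channels),
in the order of delivery. -/
abbrev Batch (n : ℕ) (M : Type*) := List (Fin n × M)

/-- One round of the game tree: the scheduler chooses a player and the messages delivered to it
(named by the index of the step and the slot in which they were sent), then the player acts. -/
structure Step (n : ℕ) (M O : Type*) where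
  player : Fin n
  delivered : List (ℕ × ℕ)
  received : Batch n M
  act : Action n M O

/-- A history is a finite sequence of scheduler and player moves. -/
abbrev History (n : ℕ) (M O : Type*) := List (Step n M O)

/-- A play, given by the sequence of its finite histories. -/
abbrev Play (n : ℕ) (M O : Type*) := ℕ → History n M O

/-- The information set of a player: its input, the messages delivered to it so far and its own
past actions. -/
structure LocalState (n : ℕ) (V M O : Type*) where
  input : V
  past : List (Batch n M × Action n M O)
  inbox : Batch n M

/-- A (symbolic) digital signature: the signer and the signed statement. -/
abbrev Signature (n : ℕ) (S : Type*) := Fin n × S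

/-- A deterministic message-passing protocol with proposals in `V`, signed statements in `S`,
messages in `M` and outputs in `O`: the next action of a player is a function of its proposal and of
the batches delivered to it so far (the last one being the current one). `msgSigs` and `outSigs`
list the signatures that a message or an output contains. -/
structure Protocol (n : ℕ) (V S M O : Type*) where
  msgSigs : M → Set (Signature n S)
  outSigs : O → Set (Signature n S)
  act : Fin n → V → List (Batch n M) → Action n M O

section Network

variable {n : ℕ} {V S M O : Type*}

/-- The message named `id` with recipient `p`, if there is one. -/
def message (h : History n M O) (p : Fin n) (id : ℕ × ℕ) : Option (Fin n × M) :=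
  (h[id.1]?).bind fun s => (s.act.send p id.2).map fun m => (s.player, m)

/-- The contents of the delivered messages. -/
def receive (h : History n M O) (p : Fin n) (ids : List (ℕ × ℕ)) : Batch n M :=
  ids.filterMap (message h p)

/-- A legal scheduler move: distinct messages to `p` that are in transit. -/
def LegalDelivery (h : History n M O) (p : Fin n) (ids : List (ℕ × ℕ)) : Prop :=
  ids.Nodup ∧ ∀ id ∈ ids, message h p id ≠ none ∧ ∀ s ∈ h, s.player = p → id ∉ s.delivered

/-- What player `i` has received and done in a history. -/
def past (i : Fin n) (h : History n M O) : List (Batch n M × Action n M O) :=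
  (h.filter fun s => s.player = i).map fun s => (s.received, s.act)

/-- Player `i` has terminated. -/
def Terminated (i : Fin n) (h : History n M O) : Prop :=
  ∃ s ∈ h, s.player = i ∧ s.act.out ≠ none

/-- `s` is the step number `m` of the play. -/
def StepAt (ω : Play n M O) (m : ℕ) (s : Step n M O) : Prop :=
  ω (m + 1) = ω m ++ [s]

/-- The player has terminated in one of its past actions. -/
def LocalState.terminated (ℓ : LocalState n V M O) : Prop :=
  ∃ b ∈ ℓ.past, b.2.out ≠ none

/-- All batches received so far, the current one last. -/
def LocalState.batches (ℓ : LocalState n V M O) : List (Batch n M) :=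
  ℓ.past.map Prod.fst ++ [ℓ.inbox]

/-- All signatures contained in what an action sends or outputs. -/
def Protocol.actionSigs (P : Protocol n V S M O) (a : Action n M O) : Set (Signature n S) :=
  {σ | (∃ p k m, a.send p k = some m ∧ σ ∈ P.msgSigs m) ∨ ∃ o, a.out = some o ∧ σ ∈ P.outSigs o}

/-- All signatures contained in a list of batches. -/
def Protocol.batchSigs (P : Protocol n V S M O) (bs : List (Batch n M)) : Set (Signature n S) :=
  {σ | ∃ b ∈ bs, ∃ m ∈ b, σ ∈ P.msgSigs m.2}

/-- The protocol instructs no player to use a foreign signature that it has not received. -/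
def Protocol.NoForging (P : Protocol n V S M O) : Prop :=
  ∀ i v bs, ∀ σ ∈ P.actionSigs (P.act i v bs), σ.1 = i ∨ σ ∈ P.batchSigs bs

open Classical in
/-- The action that the protocol prescribes; a terminated player does nothing. -/
noncomputable def Protocol.prescribed (P : Protocol n V S M O) (i : Fin n)
    (ℓ : LocalState n V M O) : Action n M O :=
  if ℓ.terminated then Action.noop else P.act i ℓ.input ℓ.batches

/-- Player `i` follows the protocol throughout the play. -/
def Protocol.Follows (P : Protocol n V S M O) (x : Fin n → V) (ω : Play n M O) (i : Fin n) :
    Prop :=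
  ∀ m s, StepAt ω m s → s.player = i → s.act = P.prescribed i ⟨x i, past i (ω m), s.received⟩

open Classical in
/-- The players that are non-faulty in a play: those that follow the protocol throughout. -/
noncomputable def Protocol.nonfaulty (P : Protocol n V S M O) (x : Fin n → V) (ω : Play n M O) :
    Finset (Fin n) :=
  Finset.univ.filter (P.Follows x ω)

/-- Partial synchrony with bound `Δ` (counted in steps) and faulty players `F`. After some time
`GST`, every message sent by a non-faulty player is delivered within `Δ` steps, unless its recipient
has terminated; messages sent earlier are delivered by `GST + Δ`. Every player that never terminates
is scheduled infinitely often. -/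
def PartiallySynchronous (Δ : ℕ) (F : Finset (Fin n)) (ω : Play n M O) : Prop :=
  (∃ GST : ℕ, ∀ m s, StepAt ω m s → s.player ∉ F → ∀ p k, s.act.send p k ≠ none →
    ∀ τ, max m GST + Δ ≤ τ →
      Terminated p (ω τ) ∨ ∃ s' ∈ ω τ, s'.player = p ∧ (m, k) ∈ s'.delivered) ∧
  ∀ i, (∃ m, Terminated i (ω m)) ∨ ∀ m, ∃ m' ≥ m, ∃ s, StepAt ω m' s ∧ s.player = i

/-- `ω` is an execution of the protocol with proposals `x` and faulty players `F`: all players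
outside `F` follow the protocol; the players in `F` behave arbitrarily, and even know all signatures
produced so far, but cannot forge new signatures of players outside `F`. -/
def Protocol.IsExecution (P : Protocol n V S M O) (x : Fin n → V) (F : Finset (Fin n))
    (ω : Play n M O) : Prop :=
  ω 0 = [] ∧
  (∀ m, ∃ s, StepAt ω m s) ∧
  (∀ m s, StepAt ω m s →
    LegalDelivery (ω m) s.player s.delivered ∧
    s.received = receive (ω m) s.player s.delivered ∧
    (s.player ∈ F → ∀ σ ∈ P.actionSigs s.act, σ.1 ∈ F ∨
      ∃ s' ∈ ω m, s'.player = σ.1 ∧ σ ∈ P.actionSigs s'.act)) ∧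
  ∀ i, i ∉ F → P.Follows x ω i

/-- Player `i` outputs `o` in the play. -/
def Outputs (ω : Play n M O) (i : Fin n) (o : O) : Prop :=
  ∃ m, ∃ s ∈ ω m, s.player = i ∧ s.act.out = some o

end Network

/-! ## Accountable consensus -/

/-- Statements that players sign: votes for a value in a view, and any further statements that the
consensus protocol may use. -/
inductive Statement (V E : Type*) where
  | vote (view : ℕ) (value : V)
  | other (e : E)

/-- A certificate: votes for one value in one view, signed by the players in `signers`. -/
structure Certificate (n : ℕ) (V : Type*) where
  view : ℕ
  value : V
  signers : Finset (Fin n)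

/-- The signatures that make up a certificate. -/
def Certificate.sigs {n : ℕ} {V : Type*} (E : Type*) (C : Certificate n V) :
    Set (Signature n (Statement V E)) :=
  {σ | σ.1 ∈ C.signers ∧ σ.2 = Statement.vote C.view C.value}

/-- A protocol for `n = 5f+1` players whose outputs are certificates. -/
abbrev CertProtocol (f : ℕ) (V E M : Type*) :=
  Protocol (5 * f + 1) V (Statement V E) M (Certificate (5 * f + 1) V)

/-- A validity notion: which values are valid, given the proposals and the non-faulty players
(for example external validity, or "if all non-faulty players propose `v`, then only `v`"). -/
abbrev ValidityNotion (n : ℕ) (V : Type*) := (Fin n → V) → Finset (Fin n) → V → Prop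

/-- An accountable consensus protocol for `n = 5f+1` players under partial synchrony with bound `Δ`:
its outputs (predecisions) are certificates of `4f+1` votes, a correct player never votes for two
values in the same view (so such a pair of votes proves fraud), and it solves consensus whenever at
most `f` players are faulty. Nothing is required of its predecisions when more are faulty. -/
structure IsAccountableConsensus {V E M : Type*} (f Δ : ℕ) (Valid : ValidityNotion (5 * f + 1) V)
    (A : CertProtocol f V E M) : Prop where
  outSigs_eq : ∀ C, A.outSigs C = C.sigs E
  noForging : A.NoForging
  certified : ∀ i v bs C, (A.act i v bs).out = some C → 4 * f + 1 ≤ C.signers.card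
  no_equivocation : ∀ x F ω, A.IsExecution x F ω → ∀ i, i ∉ F → ∀ m s m' s',
    StepAt ω m s → s.player = i → StepAt ω m' s' → s'.player = i → ∀ w v v',
    (i, Statement.vote w v) ∈ A.actionSigs s.act →
    (i, Statement.vote w v') ∈ A.actionSigs s'.act → v = v'
  termination : ∀ x F ω, F.card ≤ f → A.IsExecution x F ω → PartiallySynchronous Δ F ω →
    ∀ i, i ∉ F → ∃ C, Outputs ω i C
  agreement : ∀ x F ω, F.card ≤ f → A.IsExecution x F ω → PartiallySynchronous Δ F ω →
    ∀ i j C C', i ∉ F → j ∉ F → Outputs ω i C → Outputs ω j C' → C.value = C'.value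
  validity : ∀ x F ω, F.card ≤ f → A.IsExecution x F ω → PartiallySynchronous Δ F ω →
    ∀ i C, i ∉ F → Outputs ω i C → Valid x (Finset.univ \ F) C.value

/-! ## The protocol with no-fork (simple) finalization -/

/-- Messages: those of the consensus layer, the finalization broadcast of the hash of a predecision
with its certificate, and cheap talk (free text and signatures), which the protocol ignores. -/
inductive Msg (n : ℕ) (V D E M : Type*) where
  | cons (m : M)
  | hashCert (h : D) (C : Certificate n V)
  | talk (text : ℕ) (sigs : Finset (Signature n (Statement V E)))

/-- A decision, with the set of players that the deciding player slashes. -/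
structure Decision (n : ℕ) (V : Type*) where
  value : V
  slashed : Finset (Fin n)

/-- The signatures contained in a message. -/
def Msg.sigs {n : ℕ} {V D E M : Type*} (consSigs : M → Set (Signature n (Statement V E))) :
    Msg n V D E M → Set (Signature n (Statement V E))
  | .cons m => consSigs m
  | .hashCert _ C => C.sigs E
  | .talk _ s => ↑s

section Finalization

variable {n : ℕ} {V D E M : Type*}

/-- The consensus-layer part of a batch. -/
def consPart (b : Batch n (Msg n V D E M)) : Batch n M :=
  b.filterMap fun m => match m.2 with
    | .cons c => some (m.1, c)
    | _ => none

/-- The finalization part of a batch. -/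
def finPart (b : Batch n (Msg n V D E M)) : List (Fin n × D × Certificate n V) :=
  b.filterMap fun m => match m.2 with
    | .hashCert h C => some (m.1, h, C)
    | _ => none

/-- A consensus-layer action, as an action of the full protocol. -/
def liftAction (a : Action n M (Certificate n V)) : Action n (Msg n V D E M) (Decision n V) where
  send := fun p k => (a.send p k).map Msg.cons
  out := none
  finite_send := fun p => (a.finite_send p).subset fun k hk h => hk (by simp [h])

open Classical in
/-- The players proven to have equivocated by two certificates: those that signed votes for
different values in the same view. -/
noncomputable def extractEquivocations (C C' : Certificate n V) : Finset (Fin n) :=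
  if C.view = C'.view ∧ C.value ≠ C'.value then C.signers ∩ C'.signers else ∅

/-- Two certificates conflict if both carry `4f+1` votes and together they prove that more than `f`
players have equivocated. -/
def ConflictCert (f : ℕ) (C C' : Certificate n V) : Prop :=
  4 * f + 1 ≤ C.signers.card ∧ 4 * f + 1 ≤ C'.signers.card ∧
    f < (extractEquivocations C C').card

/-- The arrays `hashes` and `certs` of a player. -/
abbrev Table (n : ℕ) (V D : Type*) := Fin n → Option (D × Certificate n V)

/-- Entries `j` and `l` hold different hashes with conflicting certificates. -/
def ConflictAt (f : ℕ) (T : Table n V D) (q : (D × Certificate n V) × (D × Certificate n V)) :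
    Prop :=
  (∃ j l, T j = some q.1 ∧ T l = some q.2) ∧ q.1.1 ≠ q.2.1 ∧ ConflictCert f q.1.2 q.2.2

open Classical in
/-- The decision rule of simple finalization: decide the own predecision `v` on `4f+1` matching
hashes; otherwise, on conflicting certificates, slash the equivocators and decide by the
deterministic rule `resolve`. -/
noncomputable def checkTable (f : ℕ) (H : V → D) (resolve : Certificate n V → Certificate n V → V)
    (v : V) (T : Table n V D) : Option (Decision n V) :=
  if 4 * f + 1 ≤ (Finset.univ.filter fun j => (T j).map Prod.fst = some (H v)).card then
    some ⟨v, ∅⟩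
  else if h : ∃ q, ConflictAt f T q then
    some ⟨resolve h.choose.1.2 h.choose.2.2, extractEquivocations h.choose.1.2 h.choose.2.2⟩
  else none

/-- Process delivered hashes and certificates one after the other until a decision is made. -/
noncomputable def finalize (f : ℕ) (H : V → D) (resolve : Certificate n V → Certificate n V → V)
    (v : V) : Table n V D → List (Fin n × D × Certificate n V) → Option (Decision n V)
  | T, [] => checkTable f H resolve v T
  | T, m :: ms => (checkTable f H resolve v T).or
      (finalize f H resolve v (Function.update T m.1 (some m.2)) ms)

/-- The predecision (certificate) that player `i` has obtained from the consensus layer after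
receiving the given batches. -/
def predecision (A : Protocol n V (Statement V E) M (Certificate n V)) (i : Fin n) (v : V)
    (bs : List (Batch n (Msg n V D E M))) : Option (Certificate n V) :=
  (List.range bs.length).findSome? fun j => (A.act i v ((bs.map consPart).take (j + 1))).out

/-- The action of a player in the finalization phase with predecision `C`: broadcast the hash of the
predecision with its certificate in the first move of the phase, and decide if possible. -/
noncomputable def finalizationAction (f : ℕ) (H : V → D)
    (resolve : Certificate n V → Certificate n V → V) (i : Fin n) (C : Certificate n V)
    (first : Prop) [Decidable first] (bs : List (Batch n (Msg n V D E M))) :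
    Action n (Msg n V D E M) (Decision n V) where
  send := fun _ k => if first ∧ k = 0 then some (.hashCert (H C.value) C) else none
  out := finalize f H resolve C.value
    (Function.update (fun _ => none) i (some (H C.value, C))) (bs.map finPart).flatten
  finite_send := fun _ => (Set.finite_singleton 0).subset fun k hk => by
    by_contra h
    exact hk (if_neg fun h' => h h'.2)

open Classical in
/-- The protocol with no-fork finalization on top of the consensus layer `A`, with hash function
`H`: run `A`; once it has terminated, run simple finalization. Finalization messages that arrive
earlier are buffered. -/
noncomputable def noForkProtocol (f : ℕ) (A : Protocol n V (Statement V E) M (Certificate n V))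
    (H : V → D) (resolve : Certificate n V → Certificate n V → V) :
    Protocol n V (Statement V E) (Msg n V D E M) (Decision n V) where
  msgSigs := Msg.sigs A.msgSigs
  outSigs := fun _ => ∅
  act := fun i v bs =>
    match predecision A i v bs.dropLast with
    | none => liftAction (A.act i v (bs.map consPart))
    | some C => finalizationAction f H resolve i C
        (predecision A i v bs.dropLast.dropLast = none) bs

theorem batchSigs_consPart (f : ℕ) (A : Protocol n V (Statement V E) M (Certificate n V))
    (H : V → D) (resolve : Certificate n V → Certificate n V → V)
    (bs : List (Batch n (Msg n V D E M))) :
    A.batchSigs (bs.map consPart) ⊆ (noForkProtocol f A H resolve).batchSigs bs := by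
  rintro σ ⟨b, hb, m, hm, hσ⟩
  obtain ⟨b', hb', rfl⟩ := List.mem_map.1 hb
  obtain ⟨⟨p, m'⟩, hm', h⟩ := List.mem_filterMap.1 hm
  refine ⟨b', hb', _, hm', ?_⟩
  cases m' with
  | cons c =>
    simp only [Option.some.injEq] at h
    subst h
    exact hσ
  | hashCert _ _ => simp at h
  | talk _ _ => simp at h

/-- The protocol never forges signatures, if its consensus layer does not. -/
theorem noForkProtocol_noForging (f : ℕ)
    (A : Protocol n V (Statement V E) M (Certificate n V))
    (H : V → D) (resolve : Certificate n V → Certificate n V → V)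
    (hA : A.NoForging) (hout : ∀ C, A.outSigs C = C.sigs E) :
    (noForkProtocol f A H resolve).NoForging := by
  intro i v bs σ hσ
  have hσ' : ∃ p k m, ((noForkProtocol f A H resolve).act i v bs).send p k = some m ∧
      σ ∈ Msg.sigs A.msgSigs m := by
    rcases hσ with h | ⟨o, _, h⟩
    · exact h
    · exact absurd h (Set.notMem_empty _)
  obtain ⟨p, k, m, hm, hs⟩ := hσ'
  have key : ∀ l : List (Batch n M), (∀ b ∈ l, b ∈ bs.map consPart) →
      σ ∈ A.actionSigs (A.act i v l) →
      σ.1 = i ∨ σ ∈ (noForkProtocol f A H resolve).batchSigs bs := by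
    intro l hl h
    refine (hA i v l σ h).imp id fun ⟨b, hb, h⟩ => ?_
    exact batchSigs_consPart f A H resolve bs ⟨b, hl b hb, h⟩
  simp only [noForkProtocol] at hm
  split at hm
  · simp only [liftAction, Option.map_eq_some_iff] at hm
    obtain ⟨c, hc, rfl⟩ := hm
    exact key _ (fun _ h => h) (Or.inl ⟨p, k, c, hc, hs⟩)
  · rename_i C hC
    simp only [finalizationAction] at hm
    split at hm
    · simp only [Option.some.injEq] at hm
      subst hm
      obtain ⟨j, _, hj⟩ := List.exists_of_findSome?_eq_some hC
      refine key _ (fun b hb => ?_) (Or.inr ⟨C, hj, by rw [hout]; exact hs⟩)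
      have := List.mem_of_mem_take hb
      obtain ⟨b', hb', rfl⟩ := List.mem_map.1 this
      exact List.mem_map.2 ⟨b', List.mem_of_mem_dropLast hb', rfl⟩
    · simp at hm

end Finalization

/-! ## The extensive form game -/

section Game

variable {n : ℕ} {V S M O : Type*}

/-- The actions allowed to player `i` in a local state: a terminated player does nothing, and
signatures of others can be used only if they have been received. -/
def Protocol.Allowed (P : Protocol n V S M O) (i : Fin n) (ℓ : LocalState n V M O)
    (a : Action n M O) : Prop :=
  (ℓ.terminated → a = Action.noop) ∧
    ∀ σ ∈ P.actionSigs a, σ.1 = i ∨ σ ∈ P.batchSigs ℓ.batches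

/-- Behavioral strategies of player `i`: to each local state, a distribution over the allowed
actions. -/
structure Strategy (P : Protocol n V S M O) (i : Fin n) where
  choose : LocalState n V M O → PMF (Action n M O)
  allowed : ∀ ℓ, ∀ a ∈ (choose ℓ).support, P.Allowed i ℓ a

/-- Joint strategies. -/
abbrev Profile (P : Protocol n V S M O) := ∀ i, Strategy P i

/-- The honest profile: every player follows the protocol. -/
noncomputable def honest (P : Protocol n V S M O) (hP : P.NoForging) : Profile P := fun i =>
  { choose := fun ℓ => PMF.pure (P.prescribed i ℓ)
    allowed := by
      intro ℓ a ha
      rw [PMF.support_pure, Set.mem_singleton_iff] at ha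
      subst ha
      unfold Protocol.prescribed
      split
      · refine ⟨fun _ => rfl, ?_⟩
        rintro σ (⟨p, k, m, h, _⟩ | ⟨o, h, _⟩) <;> simp [Action.noop] at h
      · rename_i h
        exact ⟨fun h' => absurd h' h, hP i ℓ.input ℓ.batches⟩ }

/-- Strategies of the scheduler: to each history, a distribution over legal scheduler moves. -/
structure SchedulerStrategy (n : ℕ) (M O : Type*) where
  move : History n M O → PMF (Fin n × List (ℕ × ℕ))
  legal : ∀ h, ∀ d ∈ (move h).support, LegalDelivery h d.1 d.2

/-- The law of the history after one more step. -/
noncomputable def nextHistory {P : Protocol n V S M O} (x : Fin n → V) (π : Profile P)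
    (s : SchedulerStrategy n M O) (h : History n M O) : PMF (History n M O) :=
  (s.move h).bind fun d =>
    ((π d.1).choose ⟨x d.1, past d.1 h, receive h d.1 d.2⟩).map fun a =>
      h ++ [⟨d.1, d.2, receive h d.1 d.2, a⟩]

/-- Histories carry the discrete σ-algebra, plays the product σ-algebra. -/
instance historyMeasurableSpace : MeasurableSpace (History n M O) := ⊤

/-- The transition kernel of the game at time `m`. -/
noncomputable def stepKernel {P : Protocol n V S M O} (x : Fin n → V) (π : Profile P)
    (s : SchedulerStrategy n M O) (m : ℕ) :
    Kernel (∀ _ : Finset.Iic m, History n M O) (History n M O) where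
  toFun := fun hs => (nextHistory x π s (hs ⟨m, Finset.mem_Iic.2 le_rfl⟩)).toMeasure
  measurable' :=
    (measurable_from_top (f := fun h => (nextHistory x π s h).toMeasure)).comp
      (measurable_pi_apply (⟨m, Finset.mem_Iic.2 le_rfl⟩ : Finset.Iic m))

instance {P : Protocol n V S M O} (x : Fin n → V) (π : Profile P)
    (s : SchedulerStrategy n M O) (m : ℕ) : IsMarkovKernel (stepKernel x π s m) :=
  ⟨fun hs => PMF.toMeasure.isProbabilityMeasure
    (nextHistory x π s (hs ⟨m, Finset.mem_Iic.2 le_rfl⟩))⟩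

/-- The law of the play induced by a joint strategy and a scheduler strategy, from the empty
history. -/
noncomputable def playLaw {P : Protocol n V S M O} (x : Fin n → V) (π : Profile P)
    (s : SchedulerStrategy n M O) : Measure (Play n M O) :=
  Kernel.traj (X := fun _ => History n M O) (stepKernel x π s) 0 fun _ => []

/-- The scheduler respects partial synchrony with bound `Δ`, whatever the players do. -/
def SchedulerStrategy.Admissible (P : Protocol n V S M O) (x : Fin n → V) (Δ : ℕ)
    (s : SchedulerStrategy n M O) : Prop :=
  ∀ π : Profile P, ∀ᵐ ω ∂playLaw x π s,
    PartiallySynchronous Δ (Finset.univ \ P.nonfaulty x ω) ω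

/-- The profile in which the players in `T` play `τ` and all others play `σ`. -/
def deviate {P : Protocol n V S M O} (σ : Profile P) (T : Finset (Fin n)) (τ : Profile P) :
    Profile P :=
  fun i => if i ∈ T then τ i else σ i

end Game

/-! ## Utilities and robustness -/

/-- Types of players. -/
inductive PlayerType where
  | correct
  | rational
  | byzantine

/-- The type vector with rational players `K` and Byzantine players `T`. -/
def typeVector {n : ℕ} (K T : Finset (Fin n)) : Fin n → PlayerType :=
  fun i => if i ∈ T then .byzantine else if i ∈ K then .rational else .correct

/-- The data of the utility model: gain `G`, deposit `L`, reward `R`, the set of coalition members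
who share the loot in a play, and the reward winner (if any) of a play. -/
structure PayoffModel (n : ℕ) (M O : Type*) where
  G : ℝ
  L : ℝ
  R : ℝ
  sharers : (Fin n → PlayerType) → Play n M O → Finset (Fin n)
  winner : (Fin n → PlayerType) → Play n M O → Option (Fin n)

section Utility

variable {n : ℕ} {V S M : Type*}

/-- Consensus: some non-faulty player decides, and all non-faulty players that decide output the
same value, which is valid. -/
def Consensus (P : Protocol n V S M (Decision n V)) (Valid : ValidityNotion n V) (x : Fin n → V)
    (ω : Play n M (Decision n V)) : Prop :=
  ∃ v, Valid x (P.nonfaulty x ω) v ∧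
    (∃ i ∈ P.nonfaulty x ω, ∃ d, Outputs ω i d) ∧
    ∀ i ∈ P.nonfaulty x ω, ∀ d, Outputs ω i d → d.value = v

/-- The number of branches: the number of different values decided by non-faulty players, and at
least one by convention. -/
noncomputable def branches (P : Protocol n V S M (Decision n V)) (x : Fin n → V)
    (ω : Play n M (Decision n V)) : ℕ :=
  max 1 {v | ∃ i ∈ P.nonfaulty x ω, ∃ d, Outputs ω i d ∧ d.value = v}.ncard

/-- Player `j` is slashed by some non-faulty player. -/
def Slashed (P : Protocol n V S M (Decision n V)) (x : Fin n → V)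
    (ω : Play n M (Decision n V)) (j : Fin n) : Prop :=
  ∃ i ∈ P.nonfaulty x ω, ∃ d, Outputs ω i d ∧ j ∈ d.slashed

open Classical in
/-- The payoff of a rational player `i` in a play. -/
noncomputable def payoff (P : Protocol n V S M (Decision n V)) (Valid : ValidityNotion n V)
    (U : PayoffModel n M (Decision n V)) (x : Fin n → V) (θ : Fin n → PlayerType) (i : Fin n)
    (ω : Play n M (Decision n V)) : ℝ :=
  (if Consensus P Valid x ω then 1 else 0)
  + (if 2 ≤ branches P x ω ∧ i ∈ U.sharers θ ω then
      ((branches P x ω : ℝ) - 1) * U.G / ((U.sharers θ ω).card : ℝ) else 0)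
  + (if U.winner θ ω = some i then U.R else 0)
  - (if Slashed P x ω i then U.L else 0)

/-- The (expected) utility of a rational player `i`. -/
noncomputable def utility (P : Protocol n V S M (Decision n V)) (Valid : ValidityNotion n V)
    (U : PayoffModel n M (Decision n V)) (x : Fin n → V) (θ : Fin n → PlayerType) (i : Fin n)
    (π : Profile P) (s : SchedulerStrategy n M (Decision n V)) : ℝ :=
  ∫ ω, payoff P Valid U x θ i ω ∂playLaw x π s

/-- `σ` is an `ε`-`(k,t)`-robust equilibrium of the game with proposals `x`: for every non-empty
coalition `K` of at most `k` rational players, every set `T` of at most `t` Byzantine players and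
all their strategies, some `i ∈ K` does not gain more than `ε` from the deviation of `K`, whatever
the strategy of the scheduler. -/
def IsRobust (P : Protocol n V S M (Decision n V)) (Valid : ValidityNotion n V)
    (U : PayoffModel n M (Decision n V)) (x : Fin n → V) (Δ : ℕ) (ε : ℝ) (k t : ℕ)
    (σ : Profile P) : Prop :=
  ∀ K T : Finset (Fin n), Disjoint K T → K.card ≤ k → T.card ≤ t → K.Nonempty →
    ∀ τ φ : Profile P, ∃ i ∈ K, ∀ s : SchedulerStrategy n M (Decision n V),
      s.Admissible P x Δ →
      utility P Valid U x (typeVector K T) i (deviate (deviate σ K φ) T τ) s - ε ≤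
        utility P Valid U x (typeVector K T) i (deviate σ T τ) s

end Utility

end NoForkGame

namespace NoForkGame

/-! ### Almost sure properties of the law of a play -/

section PlayLaw

variable {n : ℕ} {V S M O : Type*} {P : Protocol n V S M O}

/-! The theorem combines two pathwise facts.

Safety, with at most `3f` faulty players: two sets of `4f+1` players among `5f+1` share at least
`3f+1`, hence a non-faulty one. Applied to the signers of two conflicting certificates, this yields
a non-faulty player with votes for two values in one view, which is impossible (`not_conflictCert`);
so the slashing branch never fires and every decision rests on `4f+1` matching hashes. Applied to
the supporters of two decisions, it yields a non-faulty player that broadcast or holds both values;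
its predecision is unique and the hash is injective, so the values agree (`decision_agreement`).
Hence there is a single branch, the loot term vanishes, and with zero deposit and reward the payoff
is at most 1.

Liveness, with at most `f` faulty players: the consensus layer gives all non-faulty players the same
valid predecision, their at least `4f+1` hashes are eventually delivered, and everyone non-faulty
decides (`consensus_value`). So the honest coalition earns exactly 1.

The assumptions on `A` concern executions of `A` alone. The bridge is `projStep`, which strips
finalization and cheap talk from a play; `isExecution_projStep` and `partiallySynchronous_projStep`
transfer legality and synchrony. The delicate point is unforgeability: finalization and talk also
carry signatures, and each one of a non-faulty player must be traced back to its consensus layer.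

Everything pathwise applies almost surely, since each step of a random play lies in the support of
its distribution. -/

theorem playLaw_apply_zero (x : Fin n → V) (π : Profile P) (s : SchedulerStrategy n M O) :
    ∀ᵐ ω ∂playLaw x π s, ω 0 = [] := by
  have h := Kernel.traj_map_frestrictLe_apply (X := fun _ => History n M O)
    (κ := stepKernel x π s) 0 0 (fun _ => [])
  rw [Kernel.partialTraj_self, Kernel.id_apply] at h
  have hmeas : Measurable fun hs : (∀ _ : Finset.Iic 0, History n M O) => hs ⟨0, by simp⟩ :=
    measurable_pi_apply _
  have hset : MeasurableSet {hs : (∀ _ : Finset.Iic 0, History n M O) | hs ⟨0, by simp⟩ = []} :=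
    hmeas (MeasurableSpace.measurableSet_top (s := {[]}))
  have hae : ∀ᵐ hs ∂(playLaw x π s).map (Preorder.frestrictLe (π := fun _ => History n M O) 0),
      hs ⟨0, by simp⟩ = [] := by
    unfold playLaw
    rw [h, ae_dirac_iff hset]
  exact ae_of_ae_map (Preorder.measurable_frestrictLe 0).aemeasurable hae

/-- The joint law of the first `m` histories and the next one is a composition product. On the event
that history `m` is `h`, its kernel is the law `nextHistory x π s h`, which gives no mass to the
complement of its support. -/
theorem playLaw_ae_mem_support_of_eq (x : Fin n → V) (π : Profile P) (s : SchedulerStrategy n M O)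
    (m : ℕ) (h : History n M O) :
    ∀ᵐ ω ∂playLaw x π s, ω m = h → ω (m + 1) ∈ (nextHistory x π s h).support := by
  have key := Kernel.partialTraj_compProd_eq_map_traj (X := fun _ => History n M O)
    (κ := stepKernel x π s) (Nat.zero_le m) (x₀ := fun _ => [])
  have hmeas : Measurable fun hs : (∀ _ : Finset.Iic m, History n M O) =>
      hs ⟨m, Finset.mem_Iic.2 le_rfl⟩ := measurable_pi_apply _
  have hA : MeasurableSet {hs : (∀ _ : Finset.Iic m, History n M O) |
      hs ⟨m, Finset.mem_Iic.2 le_rfl⟩ = h} :=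
    hmeas (MeasurableSpace.measurableSet_top (s := {h}))
  have hB : MeasurableSet (nextHistory x π s h).supportᶜ := MeasurableSpace.measurableSet_top
  have hmap := congrArg (fun μ => μ ({hs : (∀ _ : Finset.Iic m, History n M O) |
      hs ⟨m, Finset.mem_Iic.2 le_rfl⟩ = h} ×ˢ (nextHistory x π s h).supportᶜ)) key
  beta_reduce at hmap
  rw [Measure.compProd_apply_prod hA hB, Measure.map_apply (by fun_prop) (hA.prod hB),
    setLIntegral_eq_zero hA] at hmap
  · rw [ae_iff]
    refine measure_mono_null (fun ω hω => ?_) hmap.symm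
    simpa using hω
  · intro hs hhs
    change (nextHistory x π s _).toMeasure _ = 0
    rw [show hs ⟨m, Finset.mem_Iic.2 le_rfl⟩ = h from hhs, PMF.toMeasure_apply_eq_zero_iff _ hB]
    exact Set.disjoint_compl_right_iff_subset.2 subset_rfl

/-- The space of histories may be uncountable, so the null sets of the previous lemma cannot be
united over all `h`. Supports of `PMF`s are countable, which leaves only countably many relevant `h`
at each time. -/
theorem playLaw_ae_mem_countable (x : Fin n → V) (π : Profile P) (s : SchedulerStrategy n M O)
    (m : ℕ) : ∃ S : Set (History n M O), S.Countable ∧ ∀ᵐ ω ∂playLaw x π s, ω m ∈ S := by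
  induction m with
  | zero =>
    exact ⟨{[]}, Set.countable_singleton _, playLaw_apply_zero x π s⟩
  | succ m ih =>
    obtain ⟨S, hS, hae⟩ := ih
    refine ⟨⋃ h ∈ S, (nextHistory x π s h).support,
      hS.biUnion fun h _ => PMF.support_countable _, ?_⟩
    have hall := (ae_ball_iff hS).2 fun h _ => playLaw_ae_mem_support_of_eq x π s m h
    filter_upwards [hae, hall] with ω h1 h2
    exact Set.mem_biUnion h1 (h2 _ h1 rfl)

/-- Almost surely, every step of the play is in the support of the step distribution. -/
theorem playLaw_ae_mem_support (x : Fin n → V) (π : Profile P) (s : SchedulerStrategy n M O) :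
    ∀ᵐ ω ∂playLaw x π s, ω 0 = [] ∧ ∀ m, ω (m + 1) ∈ (nextHistory x π s (ω m)).support := by
  refine (playLaw_apply_zero x π s).and (ae_all_iff.2 fun m => ?_)
  obtain ⟨S, hS, hae⟩ := playLaw_ae_mem_countable x π s m
  have hall := (ae_ball_iff hS).2 fun h _ => playLaw_ae_mem_support_of_eq x π s m h
  filter_upwards [hae, hall] with ω h1 h2
  exact h2 _ h1 rfl

instance (x : Fin n → V) (π : Profile P) (s : SchedulerStrategy n M O) :
    IsProbabilityMeasure (playLaw x π s) := by
  unfold playLaw; infer_instance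

/-- The history after the first `m` steps. -/
def hist (st : ℕ → Step n M O) (m : ℕ) : History n M O := (List.range m).map st

/-- The steps `st` form a legal play of the game with proposals `x`. -/
structure IsLegal (P : Protocol n V S M O) (x : Fin n → V) (st : ℕ → Step n M O) : Prop where
  delivery : ∀ m, LegalDelivery (hist st m) (st m).player (st m).delivered
  received : ∀ m, (st m).received = receive (hist st m) (st m).player (st m).delivered
  allowed : ∀ m, P.Allowed (st m).player
    ⟨x (st m).player, past (st m).player (hist st m), (st m).received⟩ (st m).act

/-- In the play with steps `st`, player `i` acts as the protocol prescribes. -/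
def Obeys (P : Protocol n V S M O) (x : Fin n → V) (st : ℕ → Step n M O) (i : Fin n) : Prop :=
  ∀ m, (st m).player = i → (st m).act = P.prescribed i ⟨x i, past i (hist st m), (st m).received⟩

theorem hist_succ (st : ℕ → Step n M O) (m : ℕ) : hist st (m + 1) = hist st m ++ [st m] := by
  simp [hist, List.range_succ]

theorem mem_hist {st : ℕ → Step n M O} {m : ℕ} {s : Step n M O} :
    s ∈ hist st m ↔ ∃ l < m, st l = s := by
  simp [hist]

theorem hist_getElem? (st : ℕ → Step n M O) (m l : ℕ) :
    (hist st m)[l]? = if l < m then some (st l) else none := by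
  unfold hist
  split
  all_goals simp [*]

theorem stepAt_hist {st : ℕ → Step n M O} {m : ℕ} {s : Step n M O} :
    StepAt (hist st) m s ↔ st m = s := by
  simp [StepAt, hist_succ]

theorem follows_hist {x : Fin n → V} {st : ℕ → Step n M O} {i : Fin n} :
    P.Follows x (hist st) i ↔ Obeys P x st i := by
  simp [Protocol.Follows, Obeys, stepAt_hist]

theorem playLaw_ae_legal (x : Fin n → V) (π : Profile P) (s : SchedulerStrategy n M O) :
    ∀ᵐ ω ∂playLaw x π s, ∃ st, ω = hist st ∧ IsLegal P x st ∧
      ∀ m, (st m).act ∈ ((π (st m).player).choose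
        ⟨x (st m).player, past (st m).player (hist st m), (st m).received⟩).support := by
  filter_upwards [playLaw_ae_mem_support x π s] with ω ⟨h0, hstep⟩
  have hex : ∀ m, ∃ q : Step n M O, ω (m + 1) = ω m ++ [q] ∧
      LegalDelivery (ω m) q.player q.delivered ∧
      q.received = receive (ω m) q.player q.delivered ∧
      q.act ∈ ((π q.player).choose ⟨x q.player, past q.player (ω m), q.received⟩).support := by
    intro m
    have h := hstep m
    unfold nextHistory at h
    rw [PMF.mem_support_bind_iff] at h
    obtain ⟨d, hd, h⟩ := h
    rw [PMF.mem_support_map_iff] at h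
    obtain ⟨a, ha, h⟩ := h
    exact ⟨⟨d.1, d.2, receive (ω m) d.1 d.2, a⟩, h.symm, s.legal _ d hd, rfl, ha⟩
  choose st hst hdel hrec hact using hex
  have hω : ω = hist st := by
    funext m
    induction m with
    | zero => exact h0
    | succ m ih => rw [hst, hist_succ, ih]
  subst hω
  exact ⟨st, rfl, ⟨hdel, hrec, fun m => (π _).allowed _ _ (hact m)⟩, hact⟩

/-- Almost surely, the play is legal, and a player that uses the honest strategy obeys the
protocol. -/
theorem playLaw_ae_obeys (x : Fin n → V) (hP : P.NoForging) (π : Profile P)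
    (s : SchedulerStrategy n M O) :
    ∀ᵐ ω ∂playLaw x π s, ∃ st, ω = hist st ∧ IsLegal P x st ∧
      ∀ i, π i = honest P hP i → Obeys P x st i := by
  filter_upwards [playLaw_ae_legal x π s] with ω ⟨st, h1, h2, h3⟩
  refine ⟨st, h1, h2, fun i hi m hm => ?_⟩
  have h := h3 m
  rw [hm, hi] at h
  simpa [honest] using h

end PlayLaw

/-! ### Bookkeeping for histories, deliveries and signatures -/

section Histories

variable {n : ℕ} {V S M O : Type*} {P : Protocol n V S M O}

/-- The batches delivered to player `i` in a history. -/
def batchesOf (i : Fin n) (h : History n M O) : List (Batch n M) := (past i h).map Prod.fst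

theorem batchesOf_append_singleton (i : Fin n) (h : History n M O) (s : Step n M O) :
    batchesOf i (h ++ [s]) =
      if s.player = i then batchesOf i h ++ [s.received] else batchesOf i h := by
  unfold batchesOf past
  split <;> simp [List.filter_append, *]

theorem batchesOf_hist_succ (st : ℕ → Step n M O) (i : Fin n) (m : ℕ) :
    batchesOf i (hist st (m + 1)) =
      if (st m).player = i then batchesOf i (hist st m) ++ [(st m).received]
      else batchesOf i (hist st m) := by
  rw [hist_succ, batchesOf_append_singleton]

theorem localState_batches (v : V) (i : Fin n) (h : History n M O) (b : Batch n M) :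
    (⟨v, past i h, b⟩ : LocalState n V M O).batches = batchesOf i h ++ [b] := rfl

theorem localState_terminated_iff (v : V) (i : Fin n) (h : History n M O) (b : Batch n M) :
    (⟨v, past i h, b⟩ : LocalState n V M O).terminated ↔ Terminated i h := by
  simp [LocalState.terminated, Terminated, past, and_assoc]

theorem mem_batchesOf_hist {st : ℕ → Step n M O} {i : Fin n} {m : ℕ} {b : Batch n M} :
    b ∈ batchesOf i (hist st m) ↔ ∃ l < m, (st l).player = i ∧ (st l).received = b := by
  simp [batchesOf, past, mem_hist, and_assoc]

theorem message_hist_eq_some {st : ℕ → Step n M O} {m : ℕ} {p : Fin n} {id : ℕ × ℕ}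
    {q : Fin n × M} :
    message (hist st m) p id = some q ↔
      id.1 < m ∧ (st id.1).player = q.1 ∧ (st id.1).act.send p id.2 = some q.2 := by
  obtain ⟨q, c⟩ := q
  unfold message
  rw [hist_getElem?]
  split <;> simp [*, and_comm]

theorem terminated_hist {st : ℕ → Step n M O} {i : Fin n} {m : ℕ} :
    Terminated i (hist st m) ↔ ∃ l < m, (st l).player = i ∧ (st l).act.out ≠ none := by
  simp [Terminated, mem_hist]

theorem outputs_hist {st : ℕ → Step n M O} {i : Fin n} {o : O} :
    Outputs (hist st) i o ↔ ∃ l, (st l).player = i ∧ (st l).act.out = some o := by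
  constructor
  · rintro ⟨m, s, hs, h1, h2⟩
    obtain ⟨l, -, rfl⟩ := mem_hist.1 hs
    exact ⟨l, h1, h2⟩
  · rintro ⟨l, h1, h2⟩
    exact ⟨l + 1, st l, mem_hist.2 ⟨l, l.lt_succ_self, rfl⟩, h1, h2⟩

theorem IsLegal.sent_of_mem_received {x : Fin n → V} {st : ℕ → Step n M O}
    (hL : IsLegal P x st) {m : ℕ} {q : Fin n} {c : M} (h : (q, c) ∈ (st m).received) :
    ∃ l < m, (st l).player = q ∧ ∃ k, (st l).act.send (st m).player k = some c := by
  rw [hL.received, receive, List.mem_filterMap] at h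
  obtain ⟨id, -, h⟩ := h
  obtain ⟨h1, h2, h3⟩ := message_hist_eq_some.1 h
  exact ⟨id.1, h1, h2, id.2, h3⟩

/-- Delivered messages were sent at strictly earlier steps. This strict decrease drives the
induction that traces signatures to their origin. -/
theorem IsLegal.actionSigs_of_mem_batchSigs {x : Fin n → V} {st : ℕ → Step n M O}
    (hL : IsLegal P x st) {m : ℕ} {σ : Signature n S}
    (h : σ ∈ P.batchSigs (batchesOf (st m).player (hist st m) ++ [(st m).received])) :
    ∃ l < m, σ ∈ P.actionSigs (st l).act := by
  obtain ⟨b, hb, ⟨q, c⟩, hc, hσ⟩ := h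
  have hm : ∃ l ≤ m, (q, c) ∈ (st l).received := by
    rcases List.mem_append.1 hb with hb | hb
    · obtain ⟨l, hl, -, rfl⟩ := mem_batchesOf_hist.1 hb
      exact ⟨l, hl.le, hc⟩
    · rw [List.mem_singleton.1 hb] at hc
      exact ⟨m, le_rfl, hc⟩
  obtain ⟨l, hl, hc⟩ := hm
  obtain ⟨l', hl', -, k, hk⟩ := hL.sent_of_mem_received hc
  exact ⟨l', hl'.trans_le hl, Or.inl ⟨_, _, _, hk, hσ⟩⟩

end Histories

/-! ### Persistence and uniqueness of predecisions -/

section Predecision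

variable {n : ℕ} {V D E M : Type*} {A : Protocol n V (Statement V E) M (Certificate n V)}

theorem findSome?_congr_mem {α β : Type*} {l : List α} {g h : α → Option β}
    (H : ∀ a ∈ l, g a = h a) : l.findSome? g = l.findSome? h := by
  induction l with
  | nil => rfl
  | cons a l ih =>
    rw [List.findSome?_cons, List.findSome?_cons, H a List.mem_cons_self,
      ih fun b hb => H b (List.mem_cons_of_mem _ hb)]

theorem predecision_append_singleton (i : Fin n) (v : V) (bs : List (Batch n (Msg n V D E M)))
    (b : Batch n (Msg n V D E M)) :
    predecision A i v (bs ++ [b]) =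
      (predecision A i v bs).or (A.act i v ((bs ++ [b]).map consPart)).out := by
  unfold predecision
  rw [List.length_append, List.length_singleton, List.range_succ, List.findSome?_append]
  congr 1
  · refine findSome?_congr_mem fun j hj => ?_
    rw [List.map_append, List.take_append_of_le_length]
    simpa using hj
  · simp [List.take_of_length_le]

theorem predecision_mono {O : Type*} {st : ℕ → Step n (Msg n V D E M) O} {i : Fin n} {v : V}
    {C : Certificate n V} {l m : ℕ} (hlm : l ≤ m)
    (h : predecision A i v (batchesOf i (hist st l)) = some C) :
    predecision A i v (batchesOf i (hist st m)) = some C := by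
  induction m, hlm using Nat.le_induction with
  | base => exact h
  | succ m _ ih =>
    rw [batchesOf_hist_succ]
    split
    · rw [predecision_append_singleton, ih, Option.some_or]
    · exact ih

/-- A predecision, once obtained, persists, so any two are equal at the later of the two times. This
is why a non-faulty player can support only one value. -/
theorem predecision_unique {O : Type*} {st : ℕ → Step n (Msg n V D E M) O} {i : Fin n} {v : V}
    {C C' : Certificate n V} {l m : ℕ}
    (h : predecision A i v (batchesOf i (hist st l)) = some C)
    (h' : predecision A i v (batchesOf i (hist st m)) = some C') : C = C' := by
  have h1 := predecision_mono (le_max_left l m) h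
  have h2 := predecision_mono (le_max_right l m) h'
  exact Option.some_injective _ (h1.symm.trans h2)

end Predecision

/-! ### Projecting a play to its consensus layer -/

section Projection

variable {n : ℕ} {V D E M : Type*}

/-- The consensus-layer part of a message. -/
def Msg.consensus? : Msg n V D E M → Option M
  | .cons c => some c
  | _ => none

/-- The consensus-layer part of a message with its sender. -/
def consOf (q : Fin n × Msg n V D E M) : Option (Fin n × M) := q.2.consensus?.map fun c => (q.1, c)

theorem consPart_eq_filterMap (b : Batch n (Msg n V D E M)) :
    consPart b = b.filterMap consOf := by
  unfold consPart
  congr 1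
  funext ⟨q, m⟩
  cases m <;> rfl

open Classical in
/-- The consensus-layer part of step `m` of a play in which the players outside `F` obey the
protocol. An output of a player in `F` becomes a certificate without signatures. -/
noncomputable def projStep (A : Protocol n V (Statement V E) M (Certificate n V))
    (x : Fin n → V) (F : Finset (Fin n)) (st : ℕ → Step n (Msg n V D E M) (Decision n V)) (m : ℕ) :
    Step n M (Certificate n V) where
  player := (st m).player
  -- Steps are neither removed nor renumbered, so messages keep their names; only deliveries of
  -- other message kinds are dropped.
  delivered := (st m).delivered.filter fun id =>
    ((message (hist st m) (st m).player id).bind consOf).isSome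
  received := consPart (st m).received
  act :=
    if (st m).player ∈ F then
      { send := fun p k => ((st m).act.send p k).bind Msg.consensus?
        out := (st m).act.out.map fun _ => ⟨0, x (st m).player, ∅⟩
        finite_send := fun p => ((st m).act.finite_send p).subset fun k hk h => hk (by simp [h]) }
    else if predecision A (st m).player (x (st m).player)
        (batchesOf (st m).player (hist st m)) = none then
      A.act (st m).player (x (st m).player)
        ((batchesOf (st m).player (hist st m) ++ [(st m).received]).map consPart)
    else Action.noop

variable {f : ℕ} {A : Protocol n V (Statement V E) M (Certificate n V)} {H : V → D}
  {resolve : Certificate n V → Certificate n V → V} {x : Fin n → V} {F : Finset (Fin n)}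
  {st : ℕ → Step n (Msg n V D E M) (Decision n V)}

/-- The three phases of an obedient player: terminated, running the consensus layer, finalizing. -/
theorem Obeys.act_cases {m : ℕ} {i : Fin n} (hO : Obeys (noForkProtocol f A H resolve) x st i)
    (hi : (st m).player = i) :
    (Terminated i (hist st m) ∧ (st m).act = Action.noop) ∨
    (¬ Terminated i (hist st m) ∧ predecision A i (x i) (batchesOf i (hist st m)) = none ∧
      (st m).act =
        liftAction (A.act i (x i) ((batchesOf i (hist st m) ++ [(st m).received]).map consPart))) ∨
    (¬ Terminated i (hist st m) ∧ ∃ C, predecision A i (x i) (batchesOf i (hist st m)) = some C ∧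
      ∃ inst : Decidable (predecision A i (x i) (batchesOf i (hist st m)).dropLast = none),
      (st m).act = @finalizationAction _ _ _ _ _ f H resolve i C
        (predecision A i (x i) (batchesOf i (hist st m)).dropLast = none) inst
        (batchesOf i (hist st m) ++ [(st m).received])) := by
  have h := hO m hi
  unfold Protocol.prescribed at h
  rw [localState_terminated_iff, localState_batches] at h
  by_cases hT : Terminated i (hist st m)
  · rw [if_pos hT] at h
    exact Or.inl ⟨hT, h⟩
  · rw [if_neg hT] at h
    refine Or.inr ?_
    simp only [noForkProtocol] at h
    split at h
    · rename_i hp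
      rw [List.dropLast_concat] at hp
      exact Or.inl ⟨hT, hp, h⟩
    · rename_i C hp
      simp only [List.dropLast_concat] at hp h
      exact Or.inr ⟨hT, C, hp, _, h⟩

theorem Obeys.predecision_of_out {m : ℕ} {i : Fin n}
    (hO : Obeys (noForkProtocol f A H resolve) x st i)
    (hi : (st m).player = i) {d : Decision n V} (hd : (st m).act.out = some d) :
    ∃ C, predecision A i (x i) (batchesOf i (hist st m)) = some C ∧
      finalize f H resolve C.value (Function.update (fun _ => none) i (some (H C.value, C)))
        ((batchesOf i (hist st m) ++ [(st m).received]).map finPart).flatten = some d := by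
  rcases hO.act_cases hi with ⟨-, h⟩ | ⟨-, -, h⟩ | ⟨-, C, hC, inst, h⟩
  · simp [h, Action.noop] at hd
  · simp [h, liftAction] at hd
  · rw [h] at hd
    exact ⟨C, hC, hd⟩

theorem Obeys.predecision_of_terminated {m : ℕ} {i : Fin n}
    (hO : Obeys (noForkProtocol f A H resolve) x st i) (hT : Terminated i (hist st m)) :
    ∃ C, predecision A i (x i) (batchesOf i (hist st m)) = some C := by
  obtain ⟨l, hl, hi, ho⟩ := terminated_hist.1 hT
  obtain ⟨d, hd⟩ := Option.ne_none_iff_exists'.1 ho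
  obtain ⟨C, hC, -⟩ := hO.predecision_of_out hi hd
  exact ⟨C, predecision_mono hl.le hC⟩

theorem projStep_player (m : ℕ) : (projStep A x F st m).player = (st m).player := rfl

theorem projStep_act_of_notMem {m : ℕ} (h : (st m).player ∉ F) :
    (projStep A x F st m).act = open Classical in
      if predecision A (st m).player (x (st m).player)
          (batchesOf (st m).player (hist st m)) = none then
        A.act (st m).player (x (st m).player)
          ((batchesOf (st m).player (hist st m) ++ [(st m).received]).map consPart)
      else Action.noop := by
  simp [projStep, h]

/-- An obedient player with a predecision sends at most hashes, which the projection erases. This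
matches the silence of a player whose consensus layer has terminated. -/
theorem projStep_send (hO : ∀ i ∉ F, Obeys (noForkProtocol f A H resolve) x st i)
    (m : ℕ) (p : Fin n) (k : ℕ) :
    (projStep A x F st m).act.send p k = ((st m).act.send p k).bind Msg.consensus? := by
  by_cases hF : (st m).player ∈ F
  · simp [projStep, hF]
  · rw [projStep_act_of_notMem hF]
    rcases (hO _ hF).act_cases rfl with ⟨hT, h⟩ | ⟨-, hp, h⟩ | ⟨-, C, hC, inst, h⟩
    · obtain ⟨C, hC⟩ := (hO _ hF).predecision_of_terminated hT
      simp [hC, h, Action.noop]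
    · rw [if_pos hp, h]
      simp only [liftAction, Option.bind_map]
      cases (A.act (st m).player (x (st m).player)
        ((batchesOf (st m).player (hist st m) ++ [(st m).received]).map consPart)).send p k <;> rfl
    · rw [h]
      simp only [hC, finalizationAction]
      split_ifs <;> simp_all [Action.noop, Msg.consensus?]

theorem message_projStep (hO : ∀ i ∉ F, Obeys (noForkProtocol f A H resolve) x st i)
    (m : ℕ) (p : Fin n) (id : ℕ × ℕ) :
    message (hist (projStep A x F st) m) p id = (message (hist st m) p id).bind consOf := by
  unfold message
  rw [hist_getElem?, hist_getElem?]
  split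
  · simp only [Option.bind_some, projStep_send hO, projStep_player]
    cases (st id.1).act.send p id.2 <;> simp [consOf]
  · rfl

theorem receive_projStep (hO : ∀ i ∉ F, Obeys (noForkProtocol f A H resolve) x st i)
    (hL : IsLegal (noForkProtocol f A H resolve) x st) (m : ℕ) :
    (projStep A x F st m).received = receive (hist (projStep A x F st) m)
      (projStep A x F st m).player (projStep A x F st m).delivered := by
  change consPart (st m).received = receive _ (st m).player (List.filter _ _)
  rw [consPart_eq_filterMap, hL.received, receive, receive, List.filterMap_filterMap,
    List.filterMap_filter]
  congr 1
  funext id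
  rw [message_projStep hO]
  cases (message (hist st m) (st m).player id).bind consOf <;> simp

theorem batchesOf_projStep (i : Fin n) (m : ℕ) :
    batchesOf i (hist (projStep A x F st) m) = (batchesOf i (hist st m)).map consPart := by
  induction m with
  | zero => rfl
  | succ m ih =>
    rw [batchesOf_hist_succ, batchesOf_hist_succ, projStep_player, ih]
    split
    · simp [projStep]
    · rfl

/-- The projected player falls silent after its first certificate, so that certificate is its only
output. -/
theorem projStep_out_iff {i : Fin n} (hi : i ∉ F) (m : ℕ) (C : Certificate n V) :
    (∃ l < m, (st l).player = i ∧ (projStep A x F st l).act.out = some C) ↔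
      predecision A i (x i) (batchesOf i (hist st m)) = some C := by
  induction m with
  | zero => simp [batchesOf, past, hist, predecision]
  | succ m ih =>
    rw [batchesOf_hist_succ]
    have hsplit : (∃ l < m + 1, (st l).player = i ∧ (projStep A x F st l).act.out = some C) ↔
        (∃ l < m, (st l).player = i ∧ (projStep A x F st l).act.out = some C) ∨
          ((st m).player = i ∧ (projStep A x F st m).act.out = some C) := by
      constructor
      · rintro ⟨l, hl, h⟩
        rcases Nat.lt_succ_iff_lt_or_eq.1 hl with hl | rfl
        exacts [Or.inl ⟨l, hl, h⟩, Or.inr h]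
      · rintro (⟨l, hl, h⟩ | h)
        exacts [⟨l, hl.trans m.lt_succ_self, h⟩, ⟨m, m.lt_succ_self, h⟩]
    rw [hsplit, ih]
    split
    · rename_i hp
      subst hp
      rw [predecision_append_singleton, projStep_act_of_notMem hi]
      rcases hq : predecision A (st m).player (x (st m).player)
        (batchesOf (st m).player (hist st m)) with _ | C'
      · simp
      · simp [Action.noop]
    · rename_i hp
      simp [hp]

theorem terminated_projStep_of_notMem {i : Fin n} (hi : i ∉ F) (m : ℕ) :
    Terminated i (hist (projStep A x F st) m) ↔
      predecision A i (x i) (batchesOf i (hist st m)) ≠ none := by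
  rw [terminated_hist, Option.ne_none_iff_exists']
  simp only [← projStep_out_iff hi, Option.ne_none_iff_exists', projStep_player]
  constructor
  · rintro ⟨l, h1, h2, C, h3⟩
    exact ⟨C, l, h1, h2, h3⟩
  · rintro ⟨C, l, h1, h2, h3⟩
    exact ⟨l, h1, h2, C, h3⟩

/-- Synchrony exempts messages to terminated recipients, so terminations must survive the
projection. Players outside `F` terminate even earlier there, on their predecision; players in `F`
do so through the dummy certificate. -/
theorem terminated_projStep (hO : ∀ i ∉ F, Obeys (noForkProtocol f A H resolve) x st i)
    {i : Fin n} {m : ℕ} (hT : Terminated i (hist st m)) :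
    Terminated i (hist (projStep A x F st) m) := by
  by_cases hi : i ∈ F
  · obtain ⟨l, hl, rfl, ho⟩ := terminated_hist.1 hT
    refine terminated_hist.2 ⟨l, hl, rfl, ?_⟩
    simpa [projStep, hi] using ho
  · obtain ⟨C, hC⟩ := (hO i hi).predecision_of_terminated hT
    rw [terminated_projStep_of_notMem hi, hC]
    simp

theorem obeys_projStep {i : Fin n} (hi : i ∉ F) : Obeys A x (projStep A x F st) i := by
  rintro m rfl
  rw [projStep_player] at hi ⊢
  rw [projStep_act_of_notMem hi, Protocol.prescribed, localState_terminated_iff,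
    terminated_projStep_of_notMem hi, localState_batches, batchesOf_projStep]
  split_ifs <;> simp_all [projStep]

end Projection

/-! ### The projection is a legal, synchronous execution of the consensus layer -/

section Execution

variable {n : ℕ} {V D E M : Type*} {f : ℕ}
  {A : Protocol n V (Statement V E) M (Certificate n V)} {H : V → D}
  {resolve : Certificate n V → Certificate n V → V} {x : Fin n → V} {F : Finset (Fin n)}
  {st : ℕ → Step n (Msg n V D E M) (Decision n V)}

/-- A signature of a player outside `F` that occurs in a play was produced by the consensus layer
of that player. -/
theorem exists_projStep_of_mem_actionSigs
    (hO : ∀ i ∉ F, Obeys (noForkProtocol f A H resolve) x st i)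
    (hL : IsLegal (noForkProtocol f A H resolve) x st)
    (hout : ∀ C, A.outSigs C = C.sigs E) (m : ℕ) (σ : Signature n (Statement V E))
    (hσ : σ ∈ (noForkProtocol f A H resolve).actionSigs (st m).act) (hF : σ.1 ∉ F) :
    ∃ l ≤ m, ((st m).player ∈ F → l < m) ∧ (st l).player = σ.1 ∧
      σ ∈ A.actionSigs (projStep A x F st l).act := by
  induction m using Nat.strong_induction_on with
  | _ m ih =>
    -- Either the acting player signs for itself, and then it is outside `F` and obeys the protocol,
    -- or the signature was received and occurs in an earlier action, where induction applies.
    rcases (hL.allowed m).2 σ hσ with hown | hrec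
    · have hp : (st m).player ∉ F := hown ▸ hF
      have hsend : ∃ p k c, (st m).act.send p k = some c ∧ σ ∈ Msg.sigs A.msgSigs c := by
        rcases hσ with h | ⟨o, _, h⟩
        · exact h
        · exact absurd h (Set.notMem_empty _)
      obtain ⟨p, k, c, hc, hs⟩ := hsend
      rcases (hO _ hp).act_cases rfl with ⟨-, h⟩ | ⟨-, hq, h⟩ | ⟨-, C, hC, inst, h⟩
      · simp [h, Action.noop] at hc
      · rw [h] at hc
        simp only [liftAction, Option.map_eq_some_iff] at hc
        obtain ⟨c', hc', rfl⟩ := hc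
        refine ⟨m, le_rfl, fun h' => absurd h' hp, hown.symm, ?_⟩
        rw [projStep_act_of_notMem hp, if_pos hq]
        exact Or.inl ⟨p, k, c', hc', hs⟩
      · rw [h] at hc
        simp only [finalizationAction] at hc
        split at hc
        · obtain rfl := Option.some_injective _ hc
          -- The broadcast certificate was already output by the sender's own consensus layer, at a
          -- step before `m`; that output contains the signature.
          obtain ⟨l, hl, hpl, ho⟩ := (projStep_out_iff hp m C).2 hC
          refine ⟨l, hl.le, fun _ => hl, hpl.trans hown.symm, Or.inr ⟨C, ho, ?_⟩⟩
          rw [hout]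
          exact hs
        · simp at hc
    · obtain ⟨l, hl, h⟩ := hL.actionSigs_of_mem_batchSigs hrec
      obtain ⟨l', hl', -, h1, h2⟩ := ih l hl h
      exact ⟨l', hl'.trans hl.le, fun _ => hl'.trans_lt hl, h1, h2⟩

theorem projStep_delivered_subset (m : ℕ) :
    (projStep A x F st m).delivered ⊆ (st m).delivered := fun _ h => (List.mem_filter.1 h).1

theorem legalDelivery_projStep (hO : ∀ i ∉ F, Obeys (noForkProtocol f A H resolve) x st i)
    (hL : IsLegal (noForkProtocol f A H resolve) x st) (m : ℕ) :
    LegalDelivery (hist (projStep A x F st) m) (projStep A x F st m).player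
      (projStep A x F st m).delivered := by
  obtain ⟨h1, h2⟩ := hL.delivery m
  refine ⟨h1.filter _, fun id hid => ⟨?_, fun s hs hp hid' => ?_⟩⟩
  · rw [message_projStep hO]
    have := (List.mem_filter.1 hid).2
    rwa [Option.isSome_iff_ne_none] at this
  · obtain ⟨l, hl, rfl⟩ := mem_hist.1 hs
    exact (h2 id (projStep_delivered_subset m hid)).2 (st l) (mem_hist.2 ⟨l, hl, rfl⟩) hp
      (projStep_delivered_subset l hid')

/-- The consensus-layer part of a play is an execution of the consensus layer. -/
theorem isExecution_projStep (hO : ∀ i ∉ F, Obeys (noForkProtocol f A H resolve) x st i)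
    (hL : IsLegal (noForkProtocol f A H resolve) x st)
    (hout : ∀ C, A.outSigs C = C.sigs E) :
    A.IsExecution x F (hist (projStep A x F st)) := by
  refine ⟨rfl, fun m => ⟨_, stepAt_hist.2 rfl⟩, fun m s hs => ?_,
    fun i hi => follows_hist.2 (obeys_projStep hi)⟩
  obtain rfl := stepAt_hist.1 hs
  refine ⟨legalDelivery_projStep hO hL m, receive_projStep hO hL m, fun hp σ hσ => ?_⟩
  rw [or_iff_not_imp_left]
  intro hF
  have hp' : (st m).player ∈ F := hp
  have hσ' : σ ∈ (noForkProtocol f A H resolve).actionSigs (st m).act := by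
    rcases hσ with ⟨p, k, c, hc, hs⟩ | ⟨o, ho, hs⟩
    · rw [projStep_send hO, Option.bind_eq_some_iff] at hc
      obtain ⟨c', hc', hcc⟩ := hc
      refine Or.inl ⟨p, k, c', hc', ?_⟩
      cases c' <;> simp [Msg.consensus?] at hcc
      subst hcc
      exact hs
    · simp only [projStep, if_pos hp', Option.map_eq_some_iff] at ho
      -- The dummy certificate has no signers, so outputs of players in `F` forge nothing.
      obtain ⟨_, _, rfl⟩ := ho
      rw [hout] at hs
      exact absurd hs.1 (Finset.notMem_empty _)
  obtain ⟨l, -, hl, h1, h2⟩ := exists_projStep_of_mem_actionSigs hO hL hout m σ hσ' hF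
  exact ⟨_, mem_hist.2 ⟨l, hl hp', rfl⟩, h1, h2⟩

/-- The consensus-layer part of a partially synchronous play is partially synchronous. -/
theorem partiallySynchronous_projStep {Δ : ℕ}
    (hO : ∀ i ∉ F, Obeys (noForkProtocol f A H resolve) x st i)
    (hL : IsLegal (noForkProtocol f A H resolve) x st)
    (hS : PartiallySynchronous Δ F (hist st)) :
    PartiallySynchronous Δ F (hist (projStep A x F st)) := by
  obtain ⟨⟨GST, hG⟩, hF⟩ := hS
  refine ⟨⟨GST, fun m s hs hp p k hk τ hτ => ?_⟩, fun i => ?_⟩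
  · obtain rfl := stepAt_hist.1 hs
    rw [projStep_send hO, Option.ne_none_iff_exists'] at hk
    obtain ⟨c, hc⟩ := hk
    obtain ⟨c', hc', hcc⟩ := Option.bind_eq_some_iff.1 hc
    rcases hG m (st m) (stepAt_hist.2 rfl) hp p k (by simp [hc']) τ hτ with h | ⟨s, hs, hsp, hd⟩
    · exact Or.inl (terminated_projStep hO h)
    · obtain ⟨l, hl, rfl⟩ := mem_hist.1 hs
      refine Or.inr ⟨_, mem_hist.2 ⟨l, hl, rfl⟩, hsp, List.mem_filter.2 ⟨hd, ?_⟩⟩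
      -- The delivered name refers to the consensus message `c'` itself, so it passes the filter of
      -- the projection.
      obtain ⟨q, hq⟩ := Option.ne_none_iff_exists'.1 ((hL.delivery l).2 _ hd).1
      obtain ⟨-, -, hq3⟩ := message_hist_eq_some.1 hq
      rw [hsp, hc'] at hq3
      obtain rfl := Option.some_injective _ hq3
      simp [hq, consOf, hcc]
  · rcases hF i with ⟨m, hm⟩ | h
    · exact Or.inl ⟨m, terminated_projStep hO hm⟩
    · refine Or.inr fun m => ?_
      obtain ⟨m', hm', s, hs, hsp⟩ := h m
      obtain rfl := stepAt_hist.1 hs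
      exact ⟨m', hm', _, stepAt_hist.2 rfl, hsp⟩

theorem mem_finPart {b : Batch n (Msg n V D E M)} {j : Fin n} {h : D} {C : Certificate n V} :
    (j, h, C) ∈ finPart b ↔ (j, Msg.hashCert h C) ∈ b := by
  unfold finPart
  rw [List.mem_filterMap]
  constructor
  · rintro ⟨⟨q, c⟩, hm, hc⟩
    cases c <;> simp at hc
    obtain ⟨rfl, rfl, rfl⟩ := hc
    exact hm
  · intro hm
    exact ⟨_, hm, rfl⟩

theorem Obeys.predecision_of_hashCert {m : ℕ} {j p : Fin n} {k : ℕ} {h : D} {C : Certificate n V}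
    (hO : Obeys (noForkProtocol f A H resolve) x st j) (hj : (st m).player = j)
    (hs : (st m).act.send p k = some (Msg.hashCert h C)) :
    predecision A j (x j) (batchesOf j (hist st m)) = some C ∧ h = H C.value := by
  rcases hO.act_cases hj with ⟨-, ha⟩ | ⟨-, -, ha⟩ | ⟨-, C', hC, inst, ha⟩
  · simp [ha, Action.noop] at hs
  · simp [ha, liftAction] at hs
  · rw [ha] at hs
    simp only [finalizationAction] at hs
    split at hs
    · simp only [Option.some.injEq, Msg.hashCert.injEq] at hs
      obtain ⟨rfl, rfl⟩ := hs
      exact ⟨hC, rfl⟩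
    · simp at hs

theorem IsLegal.sent_of_mem_finParts {m : ℕ}
    (hL : IsLegal (noForkProtocol f A H resolve) x st) {j : Fin n} {e : D × Certificate n V}
    (he : (j, e) ∈ ((batchesOf (st m).player (hist st m) ++ [(st m).received]).map
      finPart).flatten) :
    ∃ l < m, (st l).player = j ∧
      ∃ k, (st l).act.send (st m).player k = some (Msg.hashCert e.1 e.2) := by
  obtain ⟨_, hfb, he⟩ := List.mem_flatten.1 he
  obtain ⟨b, hb, rfl⟩ := List.mem_map.1 hfb
  have he := mem_finPart.1 he
  rcases List.mem_append.1 hb with hb | hb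
  · obtain ⟨l, hl, hp, rfl⟩ := mem_batchesOf_hist.1 hb
    obtain ⟨l', hl', hj, k, hk⟩ := hL.sent_of_mem_received he
    exact ⟨l', hl'.trans hl, hj, k, hp ▸ hk⟩
  · rw [List.mem_singleton.1 hb] at he
    exact hL.sent_of_mem_received he

end Execution

/-! ### The decision rule on recorded hashes -/

section Tables

variable {n : ℕ} {V D : Type*} {f : ℕ} {H : V → D}
  {resolve : Certificate n V → Certificate n V → V} {v : V}

theorem checkTable_eq_some_of_no_conflict {T : Table n V D} {d : Decision n V}
    (hT : ¬ ∃ q, ConflictAt f T q) (h : checkTable f H resolve v T = some d) :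
    d.value = v ∧ ∃ J : Finset (Fin n), 4 * f + 1 ≤ J.card ∧ ∀ j ∈ J, ∃ C, T j = some (H v, C) := by
  unfold checkTable at h
  rw [dif_neg hT] at h
  split at h
  · rename_i hc
    obtain rfl := Option.some_injective _ h
    exact ⟨rfl, _, hc, fun j hj => by simpa using hj⟩
  · simp at h

/-- A decision is made on some intermediate table. All that matters about its entries is that each
was initial or delivered. -/
theorem finalize_eq_some {T : Table n V D} {ms : List (Fin n × D × Certificate n V)}
    {d : Decision n V} (h : finalize f H resolve v T ms = some d) :
    ∃ T' : Table n V D, (∀ j e, T' j = some e → T j = some e ∨ (j, e) ∈ ms) ∧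
      checkTable f H resolve v T' = some d := by
  induction ms generalizing T with
  | nil => exact ⟨T, fun _ _ => Or.inl, h⟩
  | cons m ms ih =>
    rw [finalize, Option.or_eq_some_iff] at h
    rcases h with h | ⟨-, h⟩
    · exact ⟨T, fun _ _ => Or.inl, h⟩
    · obtain ⟨T', h1, h2⟩ := ih h
      refine ⟨T', fun j e hj => ?_, h2⟩
      rcases h1 j e hj with h' | h'
      · rw [Function.update_apply] at h'
        split at h'
        · rename_i hjm
          obtain rfl := Option.some_injective _ h'
          exact Or.inr (hjm ▸ List.mem_cons_self)
        · exact Or.inl h'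
      · exact Or.inr (List.mem_cons_of_mem _ h')

/-- Later entries overwrite earlier ones, so `hall` constrains every entry from `J`, not just one.
The final table then has `4f+1` matching hashes, unless a decision was made before. -/
theorem finalize_ne_none {J : Finset (Fin n)} (hJ : 4 * f + 1 ≤ J.card)
    {T : Table n V D} {ms : List (Fin n × D × Certificate n V)}
    (hall : ∀ j ∈ J, ∀ e, T j = some e ∨ (j, e) ∈ ms → e.1 = H v)
    (hex : ∀ j ∈ J, ∃ e, T j = some e ∨ (j, e) ∈ ms) :
    finalize f H resolve v T ms ≠ none := by
  induction ms generalizing T with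
  | nil =>
    rw [finalize, checkTable, if_pos]
    · simp
    · refine hJ.trans (Finset.card_le_card fun j hj => ?_)
      obtain ⟨e, he⟩ := hex j hj
      have := hall j hj e he
      simp only [List.not_mem_nil, or_false] at he
      simp [he, this]
  | cons m ms ih =>
    rw [finalize]
    intro h
    refine ih (T := Function.update T m.1 (some m.2)) (fun j hj e he => ?_) (fun j hj => ?_)
      (Option.or_eq_none_iff.1 h).2
    · rcases he with he | he
      · rw [Function.update_apply] at he
        split at he
        · rename_i hjm
          obtain rfl := Option.some_injective _ he
          exact hall j hj _ (Or.inr (hjm ▸ List.mem_cons_self))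
        · exact hall j hj e (Or.inl he)
      · exact hall j hj e (Or.inr (List.mem_cons_of_mem _ he))
    · by_cases hjm : j = m.1
      · exact ⟨m.2, Or.inl (by simp [hjm])⟩
      · obtain ⟨e, he⟩ := hex j hj
        refine ⟨e, ?_⟩
        rw [Function.update_of_ne hjm]
        refine he.imp_right fun h => ?_
        rcases List.mem_cons.1 h with h | h
        · exact absurd (congrArg Prod.fst h) hjm
        · exact h

end Tables

/-- Quorum intersection: `2(4f+1) - (5f+1) = 3f+1 > 3f`. -/
theorem exists_mem_inter_notMem {f : ℕ} {J J' F : Finset (Fin (5 * f + 1))}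
    (hJ : 4 * f + 1 ≤ J.card) (hJ' : 4 * f + 1 ≤ J'.card) (hF : F.card ≤ 3 * f) :
    ∃ p, p ∈ J ∧ p ∈ J' ∧ p ∉ F := by
  have h1 := Finset.card_union_add_card_inter J J'
  have h2 := Finset.card_le_univ (J ∪ J')
  rw [Fintype.card_fin] at h2
  obtain ⟨p, hp, hpF⟩ := Finset.exists_mem_notMem_of_card_lt_card
    (show F.card < (J ∩ J').card by omega)
  exact ⟨p, (Finset.mem_inter.1 hp).1, (Finset.mem_inter.1 hp).2, hpF⟩

/-! ### Safety with at most `3f` faulty players -/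

section Agreement

variable {V D E M : Type*} {f Δ : ℕ} {Valid : ValidityNotion (5 * f + 1) V}
  {A : CertProtocol f V E M} {H : V → D}
  {resolve : Certificate (5 * f + 1) V → Certificate (5 * f + 1) V → V}
  {x : Fin (5 * f + 1) → V} {F : Finset (Fin (5 * f + 1))}
  {st : ℕ → Step (5 * f + 1) (Msg (5 * f + 1) V D E M) (Decision (5 * f + 1) V)}

/-- A certificate is backed if every signer outside `F` has voted for it. -/
def Backed (A : CertProtocol f V E M) (x : Fin (5 * f + 1) → V) (F : Finset (Fin (5 * f + 1)))
    (st : ℕ → Step (5 * f + 1) (Msg (5 * f + 1) V D E M) (Decision (5 * f + 1) V))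
    (C : Certificate (5 * f + 1) V) : Prop :=
  ∀ p ∈ C.signers, p ∉ F → ∃ l, (st l).player = p ∧
    (p, Statement.vote C.view C.value) ∈ A.actionSigs (projStep A x F st l).act

theorem backed_of_sent (hA : IsAccountableConsensus f Δ Valid A)
    (hO : ∀ i ∉ F, Obeys (noForkProtocol f A H resolve) x st i)
    (hL : IsLegal (noForkProtocol f A H resolve) x st) {l k : ℕ} {p : Fin (5 * f + 1)} {h : D}
    {C : Certificate (5 * f + 1) V} (hs : (st l).act.send p k = some (Msg.hashCert h C)) :
    Backed A x F st C := by
  intro q hq hqF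
  obtain ⟨l', -, -, h1, h2⟩ := exists_projStep_of_mem_actionSigs hO hL hA.outSigs_eq l
    (q, Statement.vote C.view C.value) (Or.inl ⟨p, k, _, hs, hq, rfl⟩) hqF
  exact ⟨l', h1, h2⟩

/-- The holder need not have broadcast its predecision yet, so the output itself is examined: each
signature in it is the holder's own or, as `A` does not forge, was received. -/
theorem backed_of_predecision (hA : IsAccountableConsensus f Δ Valid A)
    (hO : ∀ i ∉ F, Obeys (noForkProtocol f A H resolve) x st i)
    (hL : IsLegal (noForkProtocol f A H resolve) x st) {i : Fin (5 * f + 1)} (hi : i ∉ F)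
    {m : ℕ} {C : Certificate (5 * f + 1) V}
    (hC : predecision A i (x i) (batchesOf i (hist st m)) = some C) :
    Backed A x F st C := by
  intro q hq hqF
  obtain ⟨l, -, rfl, ho⟩ := (projStep_out_iff hi m C).2 hC
  have hmem : (q, Statement.vote C.view C.value) ∈ A.actionSigs (projStep A x F st l).act :=
    Or.inr ⟨C, ho, by rw [hA.outSigs_eq]; exact ⟨hq, rfl⟩⟩
  have hact := hmem
  rw [projStep_act_of_notMem hi] at hact
  split at hact
  · rcases hA.noForging _ _ _ _ hact with h | h
    · exact ⟨l, h.symm, hmem⟩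
    · obtain ⟨l', -, h'⟩ := hL.actionSigs_of_mem_batchSigs
        (batchSigs_consPart f A H resolve _ h)
      obtain ⟨l'', -, -, h1, h2⟩ :=
        exists_projStep_of_mem_actionSigs hO hL hA.outSigs_eq l' _ h' hqF
      exact ⟨l'', h1, h2⟩
  · obtain ⟨_, _, _, h, _⟩ | ⟨_, h, _⟩ := hact <;> simp [Action.noop] at h

/-- The two signer sets share a player outside `F`. Backing turns its two signatures into actual
votes in an execution of `A`, against `no_equivocation`, which is assumed for any number of faulty
players. -/
theorem not_conflictCert (hA : IsAccountableConsensus f Δ Valid A)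
    (hO : ∀ i ∉ F, Obeys (noForkProtocol f A H resolve) x st i)
    (hL : IsLegal (noForkProtocol f A H resolve) x st) (hF : F.card ≤ 3 * f)
    {C C' : Certificate (5 * f + 1) V} (hC : Backed A x F st C) (hC' : Backed A x F st C') :
    ¬ ConflictCert f C C' := by
  rintro ⟨h1, h2, h3⟩
  unfold extractEquivocations at h3
  split at h3
  · rename_i hv
    obtain ⟨p, hp, hp', hpF⟩ := exists_mem_inter_notMem h1 h2 hF
    obtain ⟨l, hl, hs⟩ := hC p hp hpF
    obtain ⟨l', hl', hs'⟩ := hC' p hp' hpF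
    rw [← hv.1] at hs'
    exact hv.2 (hA.no_equivocation x F _ (isExecution_projStep hO hL hA.outSigs_eq) p hpF l _ l' _
      (stepAt_hist.2 rfl) hl (stepAt_hist.2 rfl) hl' _ _ _ hs hs')
  · simp at h3

/-- With at most `3f` faulty players, a non-faulty player only decides its own predecision, and
only if the non-faulty players in a set of `4f+1` players have the same predecision. -/
theorem decision_of_out (hA : IsAccountableConsensus f Δ Valid A) (hH : Function.Injective H)
    (hO : ∀ i ∉ F, Obeys (noForkProtocol f A H resolve) x st i)
    (hL : IsLegal (noForkProtocol f A H resolve) x st) (hF : F.card ≤ 3 * f)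
    {m : ℕ} (hi : (st m).player ∉ F) {d : Decision (5 * f + 1) V}
    (hd : (st m).act.out = some d) :
    ∃ C, predecision A (st m).player (x (st m).player) (batchesOf (st m).player (hist st m)) =
        some C ∧ d.value = C.value ∧
      ∃ J : Finset (Fin (5 * f + 1)), 4 * f + 1 ≤ J.card ∧ ∀ j ∈ J, j ∉ F →
        ∃ l C', predecision A j (x j) (batchesOf j (hist st l)) = some C' ∧ C'.value = d.value := by
  obtain ⟨C, hC, hfin⟩ := (hO _ hi).predecision_of_out rfl hd
  obtain ⟨T, hT, hcheck⟩ := finalize_eq_some hfin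
  -- A table entry is the decider's own predecision or comes from a message that player `j` really
  -- sent, as channels are authenticated.
  have hent : ∀ j e, T j = some e → (j = (st m).player ∧ e = (H C.value, C)) ∨
      ∃ l, (st l).player = j ∧
        ∃ k, (st l).act.send (st m).player k = some (Msg.hashCert e.1 e.2) := by
    intro j e he
    rcases hT j e he with h | h
    · rw [Function.update_apply] at h
      split at h
      · rename_i hj
        exact Or.inl ⟨hj, (Option.some_injective _ h).symm⟩
      · simp at h
    · obtain ⟨l, -, h⟩ := hL.sent_of_mem_finParts h
      exact Or.inr ⟨l, h⟩
  have hback : ∀ j e, T j = some e → Backed A x F st e.2 := by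
    intro j e he
    rcases hent j e he with ⟨-, rfl⟩ | ⟨l, -, k, hk⟩
    · exact backed_of_predecision hA hO hL hi hC
    · exact backed_of_sent hA hO hL hk
  have hno : ¬ ∃ q, ConflictAt f T q := by
    rintro ⟨q, ⟨j, l, hj, hl⟩, -, hconf⟩
    exact not_conflictCert hA hO hL hF (hback _ _ hj) (hback _ _ hl) hconf
  obtain ⟨hv, J, hJ, hJT⟩ := checkTable_eq_some_of_no_conflict hno hcheck
  refine ⟨C, hC, hv, J, hJ, fun j hj hjF => ?_⟩
  obtain ⟨C', hC'⟩ := hJT j hj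
  rcases hent j _ hC' with ⟨rfl, -⟩ | ⟨l, hl, k, hk⟩
  · exact ⟨m, C, hC, hv.symm⟩
  · obtain ⟨h1, h2⟩ := (hO j hjF).predecision_of_hashCert hl hk
    exact ⟨l, C', h1, by rw [hv, hH h2]⟩

/-- With at most `3f` faulty players, non-faulty players never decide different values. -/
theorem decision_agreement (hA : IsAccountableConsensus f Δ Valid A) (hH : Function.Injective H)
    (hO : ∀ i ∉ F, Obeys (noForkProtocol f A H resolve) x st i)
    (hL : IsLegal (noForkProtocol f A H resolve) x st) (hF : F.card ≤ 3 * f)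
    {i j : Fin (5 * f + 1)} (hi : i ∉ F) (hj : j ∉ F) {d d' : Decision (5 * f + 1) V}
    (hd : Outputs (hist st) i d) (hd' : Outputs (hist st) j d') : d.value = d'.value := by
  obtain ⟨m, rfl, ho⟩ := outputs_hist.1 hd
  obtain ⟨m', rfl, ho'⟩ := outputs_hist.1 hd'
  obtain ⟨_, -, -, J, hJ, h⟩ := decision_of_out hA hH hO hL hF hi ho
  obtain ⟨_, -, -, J', hJ', h'⟩ := decision_of_out hA hH hO hL hF hj ho'
  obtain ⟨p, hp, hp', hpF⟩ := exists_mem_inter_notMem hJ hJ' hF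
  obtain ⟨l, C, hC, hv⟩ := h p hp hpF
  obtain ⟨l', C', hC', hv'⟩ := h' p hp' hpF
  rw [← hv, ← hv', predecision_unique hC hC']

end Agreement

/-! ### Liveness with at most `f` faulty players -/

section Liveness

/-- The protocol recognizes the first move of finalization by dropping the last batch. This
interprets the shortened list as the player's view at its previous move. -/
theorem batchesOf_eq_nil_or {n : ℕ} {M O : Type*} (st : ℕ → Step n M O) (i : Fin n) (m : ℕ) :
    batchesOf i (hist st m) = [] ∨ ∃ l < m, (st l).player = i ∧
      (batchesOf i (hist st m)).dropLast = batchesOf i (hist st l) := by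
  induction m with
  | zero => exact Or.inl rfl
  | succ m ih =>
    rw [batchesOf_hist_succ]
    split
    · rename_i h
      exact Or.inr ⟨m, m.lt_succ_self, h, by simp⟩
    · exact ih.imp_right fun ⟨l, hl, h⟩ => ⟨l, hl.trans m.lt_succ_self, h⟩

variable {V D E M : Type*} {f Δ : ℕ} {Valid : ValidityNotion (5 * f + 1) V}
  {A : CertProtocol f V E M} {H : V → D}
  {resolve : Certificate (5 * f + 1) V → Certificate (5 * f + 1) V → V}
  {x : Fin (5 * f + 1) → V} {F : Finset (Fin (5 * f + 1))}
  {st : ℕ → Step (5 * f + 1) (Msg (5 * f + 1) V D E M) (Decision (5 * f + 1) V)}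

theorem exists_valid_predecision (hA : IsAccountableConsensus f Δ Valid A)
    (hO : ∀ i ∉ F, Obeys (noForkProtocol f A H resolve) x st i)
    (hL : IsLegal (noForkProtocol f A H resolve) x st) (hF : F.card ≤ f)
    (hS : PartiallySynchronous Δ F (hist st)) :
    ∃ v, Valid x (Finset.univ \ F) v ∧
      (∀ i ∉ F, ∃ m C, predecision A i (x i) (batchesOf i (hist st m)) = some C) ∧
      ∀ i ∉ F, ∀ m C, predecision A i (x i) (batchesOf i (hist st m)) = some C → C.value = v := by
  have hE := isExecution_projStep hO hL hA.outSigs_eq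
  have hS' := partiallySynchronous_projStep hO hL hS
  have hout : ∀ i ∉ F, ∀ C, Outputs (hist (projStep A x F st)) i C ↔
      ∃ m, predecision A i (x i) (batchesOf i (hist st m)) = some C := by
    intro i hi C
    simp only [outputs_hist, ← projStep_out_iff hi, projStep_player]
    constructor
    · rintro ⟨l, h⟩
      exact ⟨l + 1, l, l.lt_succ_self, h⟩
    · rintro ⟨m, l, -, h⟩
      exact ⟨l, h⟩
  obtain ⟨p, -, hp⟩ := Finset.exists_mem_notMem_of_card_lt_card
    (show F.card < (Finset.univ : Finset (Fin (5 * f + 1))).card by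
      rw [Finset.card_univ, Fintype.card_fin]; omega)
  obtain ⟨C₀, hC₀⟩ := hA.termination x F _ hF hE hS' p hp
  refine ⟨C₀.value, hA.validity x F _ hF hE hS' p C₀ hp hC₀, fun i hi => ?_,
    fun i hi m C hC => ?_⟩
  · obtain ⟨C, hC⟩ := hA.termination x F _ hF hE hS' i hi
    obtain ⟨m, hm⟩ := (hout i hi C).1 hC
    exact ⟨m, C, hm⟩
  · exact hA.agreement x F _ hF hE hS' i p C C₀ hi hp ((hout i hi C).2 ⟨m, hC⟩) hC₀

/-- A non-faulty player that obtains a predecision broadcasts its hash. -/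
theorem exists_broadcast {i : Fin (5 * f + 1)}
    (hO : Obeys (noForkProtocol f A H resolve) x st i) {m : ℕ} {C : Certificate (5 * f + 1) V}
    (hC : predecision A i (x i) (batchesOf i (hist st m)) = some C)
    (hsched : (∃ m, Terminated i (hist st m)) ∨
      ∀ m, ∃ m' ≥ m, ∃ s, StepAt (hist st) m' s ∧ s.player = i) :
    ∃ l, (st l).player = i ∧
      ∀ p, (st l).act.send p 0 = some (Msg.hashCert (H C.value) C) := by
  -- The player moves at least once with its predecision in hand: at its deciding move if it
  -- terminates, otherwise because it is scheduled again. The first such move, `Nat.find hex`, is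
  -- the broadcast.
  have hex : ∃ l, (st l).player = i ∧
      predecision A i (x i) (batchesOf i (hist st l)) = some C := by
    rcases hsched with ⟨m', hT⟩ | h
    · obtain ⟨l, -, hp, ho⟩ := terminated_hist.1 hT
      obtain ⟨d, hd⟩ := Option.ne_none_iff_exists'.1 ho
      obtain ⟨C', hC', -⟩ := hO.predecision_of_out hp hd
      exact ⟨l, hp, by rw [hC', predecision_unique hC' hC]⟩
    · obtain ⟨l, hl, s, hs, hp⟩ := h m
      obtain rfl := stepAt_hist.1 hs
      exact ⟨l, hp, predecision_mono hl hC⟩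
  classical
  have hmin : ∀ l < Nat.find hex, (st l).player = i →
      predecision A i (x i) (batchesOf i (hist st l)) = none := by
    intro l hl hp
    by_contra hne
    obtain ⟨C', hC'⟩ := Option.ne_none_iff_exists'.1 hne
    exact Nat.find_min hex hl ⟨hp, by rw [hC', predecision_unique hC' hC]⟩
  obtain ⟨hp, hpre⟩ := Nat.find_spec hex
  refine ⟨Nat.find hex, hp, fun p => ?_⟩
  rcases hO.act_cases hp with ⟨hT, -⟩ | ⟨-, hnone, -⟩ | ⟨-, C', hC', inst, h⟩
  -- An earlier termination would be an earlier move with a predecision, against minimality.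
  · obtain ⟨l, hl, hpl, ho⟩ := terminated_hist.1 hT
    obtain ⟨d, hd⟩ := Option.ne_none_iff_exists'.1 ho
    obtain ⟨C', hC', -⟩ := hO.predecision_of_out hpl hd
    rw [hmin l hl hpl] at hC'
    simp at hC'
  · simp [hnone] at hpre
  · obtain rfl : C = C' := predecision_unique hpre hC'
    have hfirst : predecision A i (x i) (batchesOf i (hist st (Nat.find hex))).dropLast = none := by
      rcases batchesOf_eq_nil_or st i (Nat.find hex) with h0 | ⟨l, hl, hpl, h0⟩
      · rw [h0] at hpre
        simp [predecision] at hpre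
      · rw [h0]
        exact hmin l hl hpl
    rw [h]
    simp [finalizationAction, hfirst]

theorem IsLegal.mem_batchesOf_of_delivered {n : ℕ} {V S M O : Type*} {P : Protocol n V S M O}
    {x : Fin n → V} {st : ℕ → Step n M O} (hL : IsLegal P x st) {l m k : ℕ} {c : M}
    (hd : (m, k) ∈ (st l).delivered) (hs : (st m).act.send (st l).player k = some c) :
    ((st m).player, c) ∈ (st l).received := by
  rw [hL.received, receive, List.mem_filterMap]
  obtain ⟨q, hq⟩ := Option.ne_none_iff_exists'.1 ((hL.delivery l).2 _ hd).1
  obtain ⟨-, h2, h3⟩ := message_hist_eq_some.1 hq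
  rw [hs] at h3
  refine ⟨_, hd, hq.trans ?_⟩
  rw [Option.some_injective _ h3, h2]

/-- With at most `f` faulty players, every non-faulty player decides. -/
theorem exists_decision (hA : IsAccountableConsensus f Δ Valid A)
    (hO : ∀ i ∉ F, Obeys (noForkProtocol f A H resolve) x st i)
    (hL : IsLegal (noForkProtocol f A H resolve) x st) (hF : F.card ≤ f)
    (hS : PartiallySynchronous Δ F (hist st)) {j : Fin (5 * f + 1)} (hj : j ∉ F) :
    ∃ d, Outputs (hist st) j d := by
  obtain ⟨v, -, hex, huniq⟩ := exists_valid_predecision hA hO hL hF hS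
  obtain ⟨⟨GST, hG⟩, hsched⟩ := hS
  have hbc : ∀ i, ∃ l, i ∉ F → (st l).player = i ∧
      ∃ e : D × Certificate (5 * f + 1) V,
        ∀ p, (st l).act.send p 0 = some (Msg.hashCert e.1 e.2) := by
    intro i
    by_cases hi : i ∈ F
    · exact ⟨0, fun h => absurd hi h⟩
    · obtain ⟨m, C, hC⟩ := hex i hi
      obtain ⟨l, h1, h2⟩ := exists_broadcast (hO i hi) hC (hsched i)
      exact ⟨l, fun _ => ⟨h1, (H C.value, C), h2⟩⟩
  choose l hl using hbc
  by_contra hnone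
  have hnT : ∀ m, ¬ Terminated j (hist st m) := by
    intro m hT
    obtain ⟨l, -, hp, ho⟩ := terminated_hist.1 hT
    obtain ⟨d, hd⟩ := Option.ne_none_iff_exists'.1 ho
    exact hnone ⟨d, outputs_hist.2 ⟨l, hp, hd⟩⟩
  obtain ⟨m₀, C, hC⟩ := hex j hj
  obtain ⟨m, hm, s, hs, hp⟩ := ((hsched j).resolve_left fun ⟨m, h⟩ => hnT m h)
    -- By this time `j` has its predecision and every non-faulty broadcast has reached it.
    (max m₀ (max (Finset.univ.sup l) GST + Δ))
  obtain rfl := stepAt_hist.1 hs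
  have hmC := predecision_mono ((le_max_left _ _).trans hm) hC
  rcases (hO j hj).act_cases hp with ⟨hT, -⟩ | ⟨-, hn, -⟩ | ⟨-, C', hC', inst, h⟩
  · exact hnT m hT
  · simp [hn] at hmC
  · have hv : C'.value = v := huniq j hj m C' hC'
    have hfin : (st m).act.out ≠ none := by
      rw [h]
      -- The non-faulty players number at least `(5f+1) - f = 4f+1`, exactly the threshold.
      refine finalize_ne_none (J := Finset.univ \ F) ?_ (fun i hi e he => ?_) (fun i hi => ?_)
      · rw [Finset.card_univ_sdiff, Fintype.card_fin]
        omega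
      · have hiF : i ∉ F := (Finset.mem_sdiff.1 hi).2
        rcases he with he | he
        · rw [Function.update_apply] at he
          split at he
          · rw [← Option.some_injective _ he]
          · simp at he
        · subst hp
          obtain ⟨l', -, hl', k, hk⟩ := hL.sent_of_mem_finParts he
          obtain ⟨h1, h2⟩ := (hO i hiF).predecision_of_hashCert hl' hk
          rw [h2, huniq i hiF _ _ h1, hv]
      · have hiF : i ∉ F := (Finset.mem_sdiff.1 hi).2
        obtain ⟨hpl, e, he⟩ := hl i hiF
        refine ⟨e, Or.inr ?_⟩
        have hle : max (l i) GST + Δ ≤ m := by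
          have := Finset.le_sup (f := l) (Finset.mem_univ i)
          have := (le_max_right _ _).trans hm
          omega
        obtain ⟨s, hs, hsp, hd⟩ := (hG (l i) _ (stepAt_hist.2 rfl) (by rwa [hpl]) j 0
          (by simp [he j]) m hle).resolve_left (hnT m)
        obtain ⟨l', hl', rfl⟩ := mem_hist.1 hs
        have hrec := hL.mem_batchesOf_of_delivered hd (he _)
        rw [hpl] at hrec
        exact List.mem_flatten.2 ⟨_, List.mem_map.2
          ⟨_, List.mem_append_left _ (mem_batchesOf_hist.2 ⟨l', hl', hsp, rfl⟩), rfl⟩,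
          mem_finPart.2 hrec⟩
    obtain ⟨d, hd⟩ := Option.ne_none_iff_exists'.1 hfin
    exact hnone ⟨d, outputs_hist.2 ⟨m, hp, hd⟩⟩

/-- With at most `f` faulty players, a partially synchronous play reaches consensus. -/
theorem consensus_value (hA : IsAccountableConsensus f Δ Valid A) (hH : Function.Injective H)
    (hO : ∀ i ∉ F, Obeys (noForkProtocol f A H resolve) x st i)
    (hL : IsLegal (noForkProtocol f A H resolve) x st) (hF : F.card ≤ f)
    (hS : PartiallySynchronous Δ F (hist st)) :
    ∃ v, Valid x (Finset.univ \ F) v ∧ (∃ i ∉ F, ∃ d, Outputs (hist st) i d) ∧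
      ∀ i ∉ F, ∀ d, Outputs (hist st) i d → d.value = v := by
  obtain ⟨v, hv, -, huniq⟩ := exists_valid_predecision hA hO hL hF hS
  obtain ⟨p, -, hp⟩ := Finset.exists_mem_notMem_of_card_lt_card
    (show F.card < (Finset.univ : Finset (Fin (5 * f + 1))).card by
      rw [Finset.card_univ, Fintype.card_fin]; omega)
  refine ⟨v, hv, ⟨p, hp, exists_decision hA hO hL hF hS hp⟩, fun i hi d hd => ?_⟩
  obtain ⟨m, rfl, ho⟩ := outputs_hist.1 hd
  obtain ⟨C, hC, h, -⟩ := decision_of_out hA hH hO hL (by omega) hi ho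
  rw [h, huniq _ hi m C hC]

end Liveness

/-! ### From plays to expected payoffs -/

section Payoffs

variable {V D E M : Type*} {f Δ : ℕ} {Valid : ValidityNotion (5 * f + 1) V}
  {A : CertProtocol f V E M} {H : V → D}
  {resolve : Certificate (5 * f + 1) V → Certificate (5 * f + 1) V → V}
  {x : Fin (5 * f + 1) → V}
  {st : ℕ → Step (5 * f + 1) (Msg (5 * f + 1) V D E M) (Decision (5 * f + 1) V)}

theorem mem_nonfaulty_hist {n : ℕ} {V S M O : Type*} {P : Protocol n V S M O} {x : Fin n → V}
    {st : ℕ → Step n M O} {i : Fin n} : i ∈ P.nonfaulty x (hist st) ↔ Obeys P x st i := by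
  simp [Protocol.nonfaulty, follows_hist]

/-- Faultiness is read off the play: a deviator that happens to follow the protocol counts as
non-faulty. The faulty set is therefore only contained in `B`. -/
theorem card_faulty_le {n : ℕ} {V S M O : Type*} {P : Protocol n V S M O} {x : Fin n → V}
    {st : ℕ → Step n M O} {B : Finset (Fin n)} (hB : ∀ i ∉ B, Obeys P x st i) :
    (Finset.univ \ P.nonfaulty x (hist st)).card ≤ B.card := by
  refine Finset.card_le_card fun i hi => ?_
  by_contra h
  exact (Finset.mem_sdiff.1 hi).2 (mem_nonfaulty_hist.2 (hB i h))

theorem obeys_of_notMem_faulty {n : ℕ} {V S M O : Type*} {P : Protocol n V S M O} {x : Fin n → V}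
    {st : ℕ → Step n M O} : ∀ i ∉ Finset.univ \ P.nonfaulty x (hist st), Obeys P x st i :=
  fun _ hi => mem_nonfaulty_hist.1 (by simpa using hi)

theorem branches_eq_one (hA : IsAccountableConsensus f Δ Valid A) (hH : Function.Injective H)
    (hL : IsLegal (noForkProtocol f A H resolve) x st) {B : Finset (Fin (5 * f + 1))}
    (hB : ∀ i ∉ B, Obeys (noForkProtocol f A H resolve) x st i) (hcard : B.card ≤ 3 * f) :
    branches (noForkProtocol f A H resolve) x (hist st) = 1 := by
  have hsub : {v | ∃ i ∈ (noForkProtocol f A H resolve).nonfaulty x (hist st),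
      ∃ d, Outputs (hist st) i d ∧ d.value = v}.Subsingleton := by
    rintro _ ⟨i, hi, d, hd, rfl⟩ _ ⟨j, hj, d', hd', rfl⟩
    exact decision_agreement hA hH obeys_of_notMem_faulty hL ((card_faulty_le hB).trans hcard)
      (by simpa using hi) (by simpa using hj) hd hd'
  -- Finiteness is recorded because `ncard` is 0 on infinite sets.
  have := hsub.finite.to_subtype
  exact max_eq_left (Set.ncard_le_one_iff_subsingleton.2 hsub)

theorem consensus_hist (hA : IsAccountableConsensus f Δ Valid A) (hH : Function.Injective H)
    (hL : IsLegal (noForkProtocol f A H resolve) x st) {B : Finset (Fin (5 * f + 1))}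
    (hB : ∀ i ∉ B, Obeys (noForkProtocol f A H resolve) x st i) (hcard : B.card ≤ f)
    (hS : PartiallySynchronous Δ
      (Finset.univ \ (noForkProtocol f A H resolve).nonfaulty x (hist st)) (hist st)) :
    Consensus (noForkProtocol f A H resolve) Valid x (hist st) := by
  have h := consensus_value hA hH obeys_of_notMem_faulty hL ((card_faulty_le hB).trans hcard) hS
  simpa [Consensus] using h

open Classical in
theorem payoff_of_branches_eq_one {n : ℕ} {V S M : Type*} {P : Protocol n V S M (Decision n V)}
    {Valid : ValidityNotion n V} {U : PayoffModel n M (Decision n V)} (hL : U.L = 0) (hR : U.R = 0)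
    {x : Fin n → V} {θ : Fin n → PlayerType} {i : Fin n} {ω : Play n M (Decision n V)}
    (h : branches P x ω = 1) :
    payoff P Valid U x θ i ω = if Consensus P Valid x ω then 1 else 0 := by
  simp [payoff, h, hL, hR]

theorem utility_le_one {n : ℕ} {V S M : Type*} {P : Protocol n V S M (Decision n V)}
    {Valid : ValidityNotion n V} {U : PayoffModel n M (Decision n V)} (hL : U.L = 0) (hR : U.R = 0)
    {x : Fin n → V} {θ : Fin n → PlayerType} {i : Fin n} {π : Profile P}
    {s : SchedulerStrategy n M (Decision n V)}
    (h : ∀ᵐ ω ∂playLaw x π s, branches P x ω = 1) : utility P Valid U x θ i π s ≤ 1 := by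
  unfold utility
  by_cases hi : Integrable (payoff P Valid U x θ i) (playLaw x π s)
  · calc ∫ ω, payoff P Valid U x θ i ω ∂playLaw x π s
        ≤ ∫ _, (1 : ℝ) ∂playLaw x π s := by
          refine integral_mono_ae hi (integrable_const _) ?_
          filter_upwards [h] with ω hω
          rw [payoff_of_branches_eq_one hL hR hω]
          split <;> norm_num
      _ = 1 := by simp
  -- A non-integrable payoff has integral 0 by convention.
  · rw [integral_undef hi]
    exact zero_le_one

theorem utility_eq_one {n : ℕ} {V S M : Type*} {P : Protocol n V S M (Decision n V)}
    {Valid : ValidityNotion n V} {U : PayoffModel n M (Decision n V)} (hL : U.L = 0) (hR : U.R = 0)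
    {x : Fin n → V} {θ : Fin n → PlayerType} {i : Fin n} {π : Profile P}
    {s : SchedulerStrategy n M (Decision n V)}
    (h : ∀ᵐ ω ∂playLaw x π s, branches P x ω = 1 ∧ Consensus P Valid x ω) :
    utility P Valid U x θ i π s = 1 := by
  have hae : payoff P Valid U x θ i =ᵐ[playLaw x π s] fun _ => 1 := by
    filter_upwards [h] with ω hω
    rw [payoff_of_branches_eq_one hL hR hω.1, if_pos hω.2]
  rw [utility, integral_congr_ae hae]
  simp

end Payoffs

end NoForkGame

theorem mainTheorem3 {V D E M : Type*} (f k t Δ : ℕ)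
    (Valid : NoForkGame.ValidityNotion (5 * f + 1) V)
    (A : NoForkGame.CertProtocol f V E M)
    (hA : NoForkGame.IsAccountableConsensus f Δ Valid A)
    (H : V → D) (hH : Function.Injective H)
    (resolve : NoForkGame.Certificate (5 * f + 1) V → NoForkGame.Certificate (5 * f + 1) V → V)
    (U : NoForkGame.PayoffModel (5 * f + 1) (NoForkGame.Msg (5 * f + 1) V D E M)
      (NoForkGame.Decision (5 * f + 1) V))
    (hL : U.L = 0) (hR : U.R = 0) (hkt : k + t ≤ 3 * f) (ht : t ≤ f)
    (x : Fin (5 * f + 1) → V) :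
    let P := NoForkGame.noForkProtocol f A H resolve
    let σ : NoForkGame.Profile P := NoForkGame.honest P
      (NoForkGame.noForkProtocol_noForging f A H resolve hA.noForging hA.outSigs_eq)
    NoForkGame.IsRobust P Valid U x Δ 0 k t σ ∧
    ∀ K T : Finset (Fin (5 * f + 1)), Disjoint K T → K.card ≤ k → T.card ≤ t →
      ∀ τ φ : NoForkGame.Profile P, ∀ s, NoForkGame.SchedulerStrategy.Admissible P x Δ s →
        (∀ᵐ ω ∂NoForkGame.playLaw x (NoForkGame.deviate (NoForkGame.deviate σ K φ) T τ) s,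
          NoForkGame.branches P x ω = 1) ∧
        ∀ i ∈ K, NoForkGame.utility P Valid U x (NoForkGame.typeVector K T) i
          (NoForkGame.deviate (NoForkGame.deviate σ K φ) T τ) s ≤ 1 := by
  intro P σ
  have hdev : ∀ K T : Finset (Fin (5 * f + 1)), K.card ≤ k → T.card ≤ t →
      ∀ τ φ : NoForkGame.Profile P, ∀ s,
        ∀ᵐ ω ∂NoForkGame.playLaw x (NoForkGame.deviate (NoForkGame.deviate σ K φ) T τ) s,
          NoForkGame.branches P x ω = 1 := by
    intro K T hK hT τ φ s
    filter_upwards [NoForkGame.playLaw_ae_obeys x (NoForkGame.noForkProtocol_noForging f A H resolve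
      hA.noForging hA.outSigs_eq) (NoForkGame.deviate (NoForkGame.deviate σ K φ) T τ) s]
    rintro _ ⟨st, rfl, hL, hO⟩
    -- Only `K ∪ T` can deviate, and it has at most `k + t ≤ 3f` members.
    refine NoForkGame.branches_eq_one hA hH hL (B := K ∪ T) (fun i hi => hO i ?_) ?_
    · rw [Finset.mem_union, not_or] at hi
      simp only [NoForkGame.deviate, if_neg hi.1, if_neg hi.2]
      rfl
    · exact (Finset.card_union_le K T).trans (by omega)
  -- Any member of `K` is a witness, since the bound 1 on deviation and the value 1 of honesty hold
  -- for all players alike.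
  refine ⟨fun K T _ hK hT ⟨i, hi⟩ τ φ => ⟨i, hi, fun s hs => ?_⟩,
    fun K T _ hK hT τ φ s _ => ⟨hdev K T hK hT τ φ s, fun i _ =>
      NoForkGame.utility_le_one hL hR (hdev K T hK hT τ φ s)⟩⟩
  rw [sub_zero, NoForkGame.utility_eq_one hL hR (π := NoForkGame.deviate σ T τ)]
  · exact NoForkGame.utility_le_one hL hR (hdev K T hK hT τ φ s)
  -- Without the coalition's deviation only `T`, of size at most `f`, can be faulty. Admissibility
  -- supplies synchrony for this profile too, so liveness applies.
  · filter_upwards [hs (NoForkGame.deviate σ T τ), NoForkGame.playLaw_ae_obeys x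
      (NoForkGame.noForkProtocol_noForging f A H resolve hA.noForging hA.outSigs_eq)
      (NoForkGame.deviate σ T τ) s]
    rintro _ hS ⟨st, rfl, hL, hO⟩
    have hB : ∀ i ∉ T, NoForkGame.Obeys P x st i := fun i hi => hO i (by
      simp only [NoForkGame.deviate, if_neg hi]
      rfl)
    exact ⟨NoForkGame.branches_eq_one hA hH hL hB (by omega),
      NoForkGame.consensus_hist hA hH hL hB (hT.trans ht) hS⟩
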